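/- Let $(X_i,\mathcal F_i,\mu_i)$ and $(Y_i,\mathcal G_i,\nu_i)$, $i=1,2$, be $\sigma$-finite measure spaces and let $(X,\mathcal F,\mu)=(X_1\times X_2,\mathcal F_1\otimes\mathcal F_2,\mu_1\otimes\mu_2)$ and $(Y,\mathcal G,\nu)=(Y_1\times Y_2,\mathcal G_1\otimes\mathcal G_2,\nu_1\otimes\nu_2)$. Definitions. A *solid Banach function space* on a measure space is a complex Banach space $\mathbf A$ of (equivalence classes of almost everywhere equal) measurable complex-valued functions such that if $f\in\mathbf A$ and $g$ is measurable with $|g|\le|f|$ a.e., then $g\in\mathbf A$ and $\|g\|_{\mathbf A}\le\|f\|_{\mathbf A}$. For a space $\mathbf A$ of measurable functions and a measurable weight $u>0$, let $\mathbf A_u=\{f\text{ measurable}: u f\in\mathbf A\}$ with $\|f\|_{\mathbf A_u}=\|uf\|_{\mathbf A}$. For $p,q\in[1,\infty]$ put $\|f\|_{L^{p,q}(\mu)}=\big\|x_2\mapsto\|f(\cdot,x_2)\|_{L^p(\mu_1)}\big\|_{L^q(\mu_2)}$. The space $L^1\cap L^\infty\cap L^{1,\infty}\cap L^{\infty,1}$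 consists of all measurable $f$ for which $\max\{\|f\|_{L^1},\|f\|_{L^\infty},\|f\|_{L^{1,\infty}},\|f\|_{L^{\infty,1}}\}$ is finite, with this norm; the space $L^1+L^\infty+L^{1,\infty}+L^{\infty,1}$ consists of all measurable $f$ for which $\inf\{\|f_1\|_{L^1}+\|f_2\|_{L^\infty}+\|f_3\|_{L^{1,\infty}}+\|f_4\|_{L^{\infty,1}}: f=f_1+f_2+f_3+f_4\}$ is finite (the infimum being over measurable $f_1,\dots,f_4$), with this norm. For measurable $K$ on a product $V\times W$ of $\sigma$-finite measure spaces $(V,\rho)$, $(W,\sigma)$ let $$\|K\|_{\mathcal A(V,W)}=\max\Big\{\operatorname*{ess\,sup}_{x\in V}\int_W|K(x,y)|\,d\sigma(y),\ \operatorname*{ess\,sup}_{y\in W}\int_V|K(x,y)|\,d\rho(x)\Big\},$$ and for measurable $K:X\times Y\to\mathbb C$ let $$\|K\|_{\mathcal B(X,Y)}=\Big\|(x_2,y_2)\mapsto\big\|(x_1,y_1)\mapsto K\big((x_1,x_2),(y_1,y_2)\big)\big\|_{\mathcal A(X_1,Y_1)}\Big\|_{\mathcal A(X_2,Y_2)}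 .$$ For measurable $m:X\times Y\to(0,\infty)$ let $\mathcal B_m(X,Y)$ be the set of all measurable $K:X\times Y\to\mathbb C$ with $\|mK\|_{\mathcal B(X,Y)}<\infty$. The integral operator with kernel $K$ is $\Phi_Kf(x)=\int_YK(x,y)f(y)\,d\nu(y)$; it is *well-defined as an operator* $\mathbf A\to\mathbf B$ if, for every $f\in\mathbf A$, the integral converges absolutely for $\mu$-almost every $x$ and $\Phi_Kf\in\mathbf B$. Finally, $\mathbf A\hookrightarrow\mathbf B$ means $\mathbf A\subset\mathbf B$ with $\|f\|_{\mathbf B}\le c\,\|f\|_{\mathbf A}$ for all $f\in\mathbf A$ and some constant $c$. Theorem. Let $m:X\times Y\to(0,\infty)$ be measurable, let $\mathbf A$ be a solid Banach function space on $Y$ and $\mathbf B$ a solid Banach function space on $X$. Let $v:X\to(0,\infty)$ and $w:Y\to(0,\infty)$ be measurable with $m(x,y)\le C\,v(x)\,w(y)$ for all $(x,y)\in X\times Y$ and some $C>0$. Then: (1) If $\mathbf A\ne\{0\}$ and every $K\in\mathcal B_m(X,Y)$ induces a well-defined operator $\Phi_K:\mathbf A\to\mathbf B$, then $$\big(L^1(\mu)\cap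 L^\infty(\mu)\cap L^{1,\infty}(\mu)\cap L^{\infty,1}(\mu)\big)_v\hookrightarrow\mathbf B .$$ (2) If $\mu(X)\ne0$ and if for each non-negative $K\in\mathcal B_m(X,Y)$ and each non-negative $f\in\mathbf A$ the function $\Phi_Kf:X\to[0,\infty]$ is finite almost everywhere, then $$\mathbf A\hookrightarrow\big(L^1(\nu)+L^\infty(\nu)+L^{1,\infty}(\nu)+L^{\infty,1}(\nu)\big)_{1/w} .$$ -/

import Mathlib

open MeasureTheory Filter Topology
open scoped ENNReal ComplexOrder

noncomputable section

namespace KernelModules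

/-- A space of (classes of almost everywhere equal) measurable functions `Ω → ℂ`, given by its set
of elements together with a norm. Only the values of `norm` on `carrier` are meaningful. -/
structure FunctionSpace {Ω : Type*} [MeasurableSpace Ω] (μ : Measure Ω) where
  carrier : Set (Ω →ₘ[μ] ℂ)
  norm : (Ω →ₘ[μ] ℂ) → ℝ

namespace FunctionSpace

variable {Ω : Type*} [MeasurableSpace Ω] {μ : Measure Ω}

/-- `A` is a solid Banach function space: a complex vector space of classes of measurable functions,
with a complete norm, such that `f ∈ A` and `|g| ≤ |f|` a.e. imply `g ∈ A` and `‖g‖ ≤ ‖f‖`. -/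
structure IsSolidBanach (A : FunctionSpace μ) : Prop where
  zero_mem : (0 : Ω →ₘ[μ] ℂ) ∈ A.carrier
  add_mem : ∀ f ∈ A.carrier, ∀ g ∈ A.carrier, f + g ∈ A.carrier
  smul_mem : ∀ c : ℂ, ∀ f ∈ A.carrier, c • f ∈ A.carrier
  norm_nonneg : ∀ f ∈ A.carrier, 0 ≤ A.norm f
  norm_eq_zero_iff : ∀ f ∈ A.carrier, (A.norm f = 0 ↔ f = 0)
  norm_add_le : ∀ f ∈ A.carrier, ∀ g ∈ A.carrier, A.norm (f + g) ≤ A.norm f + A.norm g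
  norm_smul : ∀ c : ℂ, ∀ f ∈ A.carrier, A.norm (c • f) = ‖c‖ * A.norm f
  complete : ∀ u : ℕ → (Ω →ₘ[μ] ℂ), (∀ n, u n ∈ A.carrier) →
    (∀ ε > 0, ∃ N, ∀ k ≥ N, ∀ n ≥ N, A.norm (u k - u n) < ε) →
    ∃ f ∈ A.carrier, Tendsto (fun n => A.norm (u n - f)) atTop (𝓝 0)
  solid : ∀ f ∈ A.carrier, ∀ g : Ω →ₘ[μ] ℂ, (∀ᵐ x ∂μ, ‖g x‖ ≤ ‖f x‖) →
    g ∈ A.carrier ∧ A.norm g ≤ A.norm f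

/-- The weighted space `A_w = {f : w · f ∈ A}` with norm `‖f‖_{A_w} = ‖w · f‖_A`. -/
def weighted (A : FunctionSpace μ) (w : Ω → ℝ) (hw : Measurable w) : FunctionSpace μ where
  carrier := {f | AEEqFun.mk (fun x => (w x : ℂ))
    (Complex.measurable_ofReal.comp hw).aestronglyMeasurable * f ∈ A.carrier}
  norm f := A.norm (AEEqFun.mk (fun x => (w x : ℂ))
    (Complex.measurable_ofReal.comp hw).aestronglyMeasurable * f)

/-- The continuous embedding `A ↪ B`: inclusion of sets, with a norm estimate. -/
def ContinuouslyEmbeds (A B : FunctionSpace μ) : Prop :=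
  A.carrier ⊆ B.carrier ∧ ∃ c : ℝ, ∀ f ∈ A.carrier, B.norm f ≤ c * A.norm f

end FunctionSpace

section Mixed

variable {X₁ X₂ Y₁ Y₂ : Type*} [MeasurableSpace X₁] [MeasurableSpace X₂]
  [MeasurableSpace Y₁] [MeasurableSpace Y₂]

/-- The mixed Lebesgue norm `‖ x₂ ↦ ‖f(·, x₂)‖_{L^p(μ₁)} ‖_{L^q(μ₂)} ∈ [0,∞]`. -/
def mixedNorm (p q : ℝ≥0∞) (μ₁ : Measure X₁) (μ₂ : Measure X₂) (f : X₁ × X₂ → ℂ) : ℝ≥0∞ :=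
  eLpNorm (fun x₂ => eLpNorm (fun x₁ => f (x₁, x₂)) p μ₁) q μ₂

/-- The `[0,∞]`-valued norm of `L¹ ∩ L^∞ ∩ L^{1,∞} ∩ L^{∞,1}`. -/
def interNorm (μ₁ : Measure X₁) (μ₂ : Measure X₂) (f : X₁ × X₂ →ₘ[μ₁.prod μ₂] ℂ) : ℝ≥0∞ :=
  max (max (eLpNorm f 1 (μ₁.prod μ₂)) (eLpNorm f ∞ (μ₁.prod μ₂)))
    (max (mixedNorm 1 ∞ μ₁ μ₂ f) (mixedNorm ∞ 1 μ₁ μ₂ f))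

/-- The `[0,∞]`-valued norm of `L¹ + L^∞ + L^{1,∞} + L^{∞,1}`. -/
def sumNorm (μ₁ : Measure X₁) (μ₂ : Measure X₂) (f : X₁ × X₂ →ₘ[μ₁.prod μ₂] ℂ) : ℝ≥0∞ :=
  ⨅ (f₁ : X₁ × X₂ →ₘ[μ₁.prod μ₂] ℂ) (f₂ : X₁ × X₂ →ₘ[μ₁.prod μ₂] ℂ)
    (f₃ : X₁ × X₂ →ₘ[μ₁.prod μ₂] ℂ) (f₄ : X₁ × X₂ →ₘ[μ₁.prod μ₂] ℂ)
    (_ : f = f₁ + f₂ + f₃ + f₄),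
    eLpNorm f₁ 1 (μ₁.prod μ₂) + eLpNorm f₂ ∞ (μ₁.prod μ₂)
      + mixedNorm 1 ∞ μ₁ μ₂ f₃ + mixedNorm ∞ 1 μ₁ μ₂ f₄

/-- The space `L¹ ∩ L^∞ ∩ L^{1,∞} ∩ L^{∞,1}`. -/
def interSpace (μ₁ : Measure X₁) (μ₂ : Measure X₂) : FunctionSpace (μ₁.prod μ₂) where
  carrier := {f | interNorm μ₁ μ₂ f < ∞}
  norm f := (interNorm μ₁ μ₂ f).toReal

/-- The space `L¹ + L^∞ + L^{1,∞} + L^{∞,1}`. -/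
def sumSpace (μ₁ : Measure X₁) (μ₂ : Measure X₂) : FunctionSpace (μ₁.prod μ₂) where
  carrier := {f | sumNorm μ₁ μ₂ f < ∞}
  norm f := (sumNorm μ₁ μ₂ f).toReal

/-- The `𝒜(X,Y)`-norm of a kernel, in terms of its absolute value `K : X → Y → [0,∞]`. -/
def kernelNormA {X Y : Type*} [MeasurableSpace X] [MeasurableSpace Y]
    (μ : Measure X) (ν : Measure Y) (K : X → Y → ℝ≥0∞) : ℝ≥0∞ :=
  max (essSup (fun x => ∫⁻ y, K x y ∂ν) μ) (essSup (fun y => ∫⁻ x, K x y ∂μ) ν)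

/-- The `ℬ(X,Y)`-norm of a kernel on `X × Y = (X₁ × X₂) × (Y₁ × Y₂)`. -/
def kernelNormB (μ₁ : Measure X₁) (μ₂ : Measure X₂) (ν₁ : Measure Y₁) (ν₂ : Measure Y₂)
    (K : (X₁ × X₂) × (Y₁ × Y₂) → ℂ) : ℝ≥0∞ :=
  kernelNormA μ₂ ν₂ fun x₂ y₂ => kernelNormA μ₁ ν₁ fun x₁ y₁ => ‖K ((x₁, x₂), (y₁, y₂))‖ₑ

/-- The weighted kernel module `ℬ_m(X,Y)`: measurable kernels `K` with `‖m · K‖_ℬ < ∞`. -/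
def kernelModule (μ₁ : Measure X₁) (μ₂ : Measure X₂) (ν₁ : Measure Y₁) (ν₂ : Measure Y₂)
    (m : (X₁ × X₂) × (Y₁ × Y₂) → ℝ) : Set ((X₁ × X₂) × (Y₁ × Y₂) → ℂ) :=
  {K | Measurable K ∧ kernelNormB μ₁ μ₂ ν₁ ν₂ (fun p => (m p : ℂ) * K p) < ∞}

end Mixed

section IntegralOperator

variable {X Y : Type*} [MeasurableSpace X] [MeasurableSpace Y]

/-- The integral operator `Φ_K f (x) = ∫ K(x,y) f(y) dν(y)` is well-defined as a map `A → B`: for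
each `f ∈ A` the integral converges absolutely for almost all `x`, and the resulting (class of
a) function belongs to `B`. -/
def InducesOperator {μ : Measure X} {ν : Measure Y} (K : X × Y → ℂ)
    (A : FunctionSpace ν) (B : FunctionSpace μ) : Prop :=
  ∀ f ∈ A.carrier,
    (∀ᵐ x ∂μ, Integrable (fun y => K (x, y) * f y) ν) ∧
    ∃ g ∈ B.carrier, ∀ᵐ x ∂μ, g x = ∫ y, K (x, y) * f y ∂ν

/-- `Φ_K f (x) ∈ [0,∞]` for a non-negative kernel `K` and a non-negative function `f`. -/
def nonnegIntegralOperator (ν : Measure Y) (K : X × Y → ℂ) (f : Y → ℂ) (x : X) : ℝ≥0∞ :=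
  ∫⁻ y, ENNReal.ofReal (K (x, y) * f y).re ∂ν

end IntegralOperator

end KernelModules

end

/-! Both embeddings come from testing the hypothesis on rank-one kernels `K(x, y) = a(x) b(y)`. Such
a kernel lies in `ℬ_m` as soon as `v a` and `w b` have finite norm in `L¹ ∩ L^∞ ∩ L^{1,∞} ∩ L^{∞,1}`
(`kernelNormB_lt_top`).

(1) Fix a set `E` of finite positive measure on which some `f ∈ A` does not vanish and `f`, `w` are
bounded. The kernel `h(x) 1_E(y)` maps `|f|` to a positive multiple of `h`, so `h ∈ B`.

(2) Fix a set `E` of positive measure in `X` on which `v` is bounded. The kernel `1_E(x) g(y) /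
w(y)` shows that `|f| / w` has a finite pairing with each `g ≥ 0` in the intersection space, hence
finite `dualNorm` (`dualNorm_lt_top`). It remains to bound the sum norm by such pairings. In one
variable, a threshold `s` splits a function into a part above `s` with `L¹` norm at most `s` and a
part bounded by `s`, where `s` is itself bounded by twice a pairing (`exists_threshold`). Doing this
in the first variable, and then for the resulting function `s` in the second, gives the four
summands (`exists_sumNorm_le_pairing`).

In both parts the norm estimate follows from the inclusion by a gliding hump
(`exists_bound_of_dominated`). -/

noncomputable section

namespace KernelModules

/-! ### The intersection norm of `[0,∞]`-valued functions -/

section MixedInter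

variable {α β : Type*} [MeasurableSpace α] [MeasurableSpace β]

/-- The `L¹ ∩ L^∞ ∩ L^{1,∞} ∩ L^{∞,1}` norm of a `[0,∞]`-valued function. -/
def mixedInter (μ : Measure α) (ν : Measure β) (G : α × β → ℝ≥0∞) : ℝ≥0∞ :=
  max (max (∫⁻ p, G p ∂μ.prod ν) (essSup G (μ.prod ν)))
    (max (essSup (fun b => ∫⁻ a, G (a, b) ∂μ) ν) (∫⁻ b, essSup (fun a => G (a, b)) μ ∂ν))

theorem essSup_le_iff_ae {μ : Measure α} {f : α → ℝ≥0∞} {c : ℝ≥0∞} :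
    essSup f μ ≤ c ↔ ∀ᵐ a ∂μ, f a ≤ c :=
  ⟨fun h => (ENNReal.ae_le_essSup f).mono fun _ ha => ha.trans h, fun h => essSup_le_of_ae_le c h⟩

theorem mixedInter_le_iff {μ : Measure α} {ν : Measure β} {G : α × β → ℝ≥0∞} {c : ℝ≥0∞} :
    mixedInter μ ν G ≤ c ↔ (∫⁻ p, G p ∂μ.prod ν ≤ c) ∧ (∀ᵐ p ∂μ.prod ν, G p ≤ c) ∧
      (∀ᵐ b ∂ν, ∫⁻ a, G (a, b) ∂μ ≤ c) ∧ ∫⁻ b, essSup (fun a => G (a, b)) μ ∂ν ≤ c := by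
  simp only [mixedInter, max_le_iff, essSup_le_iff_ae, and_assoc]

theorem ae_ae_of_ae_prod_right {μ : Measure α} {ν : Measure β} [SFinite μ] [SFinite ν]
    {P : α × β → Prop} (h : ∀ᵐ p ∂μ.prod ν, P p) : ∀ᵐ b ∂ν, ∀ᵐ a ∂μ, P (a, b) :=
  Measure.ae_ae_of_ae_prod
    ((Measure.measurePreserving_swap (μ := ν) (ν := μ)).quasiMeasurePreserving.ae h)

/-- A sublevel set of the essential supremum is the set where a slice measure vanishes, and slice
measures are measurable in the parameter. -/
theorem measurable_essSup_left {μ : Measure α} [SFinite μ] {G : α × β → ℝ≥0∞}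
    (hG : Measurable G) : Measurable fun b => essSup (fun a => G (a, b)) μ := by
  refine measurable_of_Iic fun c => ?_
  have h : (fun b => essSup (fun a => G (a, b)) μ) ⁻¹' Set.Iic c =
      (fun b => μ ((fun a => (a, b)) ⁻¹' {p | c < G p})) ⁻¹' {0} := by
    ext b
    simp [essSup_le_iff_ae, ae_iff]
  rw [h]
  exact measurable_measure_prodMk_right (measurableSet_lt measurable_const hG)
    (measurableSet_singleton 0)

theorem mixedInter_mono_ae {μ : Measure α} {ν : Measure β} [SFinite μ] [SFinite ν]
    {G H : α × β → ℝ≥0∞} (h : ∀ᵐ p ∂μ.prod ν, G p ≤ H p) :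
    mixedInter μ ν G ≤ mixedInter μ ν H := by
  have h' := ae_ae_of_ae_prod_right h
  refine max_le_max (max_le_max (lintegral_mono_ae h) (essSup_mono_ae h))
    (max_le_max (essSup_mono_ae ?_) (lintegral_mono_ae ?_))
  · exact h'.mono fun b hb => lintegral_mono_ae hb
  · exact h'.mono fun b hb => essSup_mono_ae hb

theorem mixedInter_const_mul_le {μ : Measure α} {ν : Measure β} [SFinite μ] [SFinite ν]
    {G : α × β → ℝ≥0∞} (hG : Measurable G) (c : ℝ≥0∞) :
    mixedInter μ ν (fun p => c * G p) ≤ c * mixedInter μ ν G := by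
  obtain ⟨h1, h2, h3, h4⟩ := mixedInter_le_iff.1 (le_refl (mixedInter μ ν G))
  refine mixedInter_le_iff.2 ⟨?_, ?_, ?_, ?_⟩
  · rw [lintegral_const_mul _ hG]
    gcongr
  · filter_upwards [h2] with p hp
    gcongr
  · filter_upwards [h3] with b hb
    rw [lintegral_const_mul _ (by fun_prop)]
    gcongr
  · simp only [ENNReal.essSup_const_mul]
    rw [lintegral_const_mul _ (measurable_essSup_left hG)]
    gcongr

/-- Countable subadditivity makes geometric series of test functions admissible, which is what the
gliding hump arguments need. -/
theorem mixedInter_tsum_le {μ : Measure α} {ν : Measure β} [SFinite μ] [SFinite ν]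
    {G : ℕ → α × β → ℝ≥0∞} (hG : ∀ n, Measurable (G n)) :
    mixedInter μ ν (fun p => ∑' n, G n p) ≤ ∑' n, mixedInter μ ν (G n) := by
  have h n := mixedInter_le_iff.1 (le_refl (mixedInter μ ν (G n)))
  refine mixedInter_le_iff.2 ⟨?_, ?_, ?_, ?_⟩
  · rw [lintegral_tsum fun n => (hG n).aemeasurable]
    exact ENNReal.tsum_le_tsum fun n => (h n).1
  · filter_upwards [ae_all_iff.2 fun n => (h n).2.1] with p hp
    exact ENNReal.tsum_le_tsum hp
  · filter_upwards [ae_all_iff.2 fun n => (h n).2.2.1] with b hb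
    rw [lintegral_tsum fun n => (by have := hG n; fun_prop)]
    exact ENNReal.tsum_le_tsum hb
  · calc ∫⁻ b, essSup (fun a => ∑' n, G n (a, b)) μ ∂ν
        ≤ ∫⁻ b, ∑' n, essSup (fun a => G n (a, b)) μ ∂ν := by
          refine lintegral_mono fun b => essSup_le_iff_ae.2 ?_
          filter_upwards [ae_all_iff.2 fun n => ENNReal.ae_le_essSup (μ := μ)
            fun a => G n (a, b)] with a ha
          exact ENNReal.tsum_le_tsum ha
      _ = ∑' n, ∫⁻ b, essSup (fun a => G n (a, b)) μ ∂ν :=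
          lintegral_tsum fun n => (measurable_essSup_left (hG n)).aemeasurable
      _ ≤ _ := ENNReal.tsum_le_tsum fun n => (h n).2.2.2

theorem ae_lt_top_of_mixedInter_lt_top {μ : Measure α} {ν : Measure β}
    {G : α × β → ℝ≥0∞} (h : mixedInter μ ν G < ∞) : ∀ᵐ p ∂μ.prod ν, G p < ∞ :=
  (mixedInter_le_iff.1 le_rfl).2.1.mono fun _ hp => hp.trans_lt h

theorem mixedInter_indicator_lt_top {μ : Measure α} {ν : Measure β}
    [SFinite μ] [SFinite ν] {S : Set α} {T : Set β} (hS : MeasurableSet S) (hT : MeasurableSet T)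
    (hμ : μ S < ∞) (hν : ν T < ∞) {E : Set (α × β)} (hE : E ⊆ S ×ˢ T) :
    mixedInter μ ν (E.indicator 1) < ∞ := by
  -- The four terms are the `L^∞`, `L^{1,∞}`, `L^{∞,1}` and `L¹` norms of the indicator of `S ×ˢ T`,
  -- in this order.
  let c := 1 + μ S + ν T + μ S * ν T
  have hc : c < ∞ := by
    simp only [c, ENNReal.add_lt_top]
    exact ⟨⟨⟨by simp, hμ⟩, hν⟩, ENNReal.mul_lt_top hμ hν⟩
  refine lt_of_le_of_lt (mixedInter_mono_ae (H := (S ×ˢ T).indicator 1)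
    (ae_of_all _ fun p => Set.indicator_le_indicator_of_subset hE (fun _ => zero_le) p)) ?_
  refine lt_of_le_of_lt ((mixedInter_le_iff (c := c)).2 ⟨?_, ?_, ?_, ?_⟩) hc
  · rw [lintegral_indicator_one (hS.prod hT), Measure.prod_prod]
    exact le_add_self
  · refine ae_of_all _ fun p => (Set.indicator_le_self' (fun _ _ => zero_le) p).trans ?_
    simp only [Pi.one_apply, c, add_assoc]
    exact le_self_add
  · refine ae_of_all _ fun b => ?_
    calc ∫⁻ a, (S ×ˢ T).indicator 1 (a, b) ∂μ ≤ ∫⁻ a, S.indicator 1 a ∂μ := by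
          refine lintegral_mono fun a => ?_
          by_cases ha : a ∈ S <;> by_cases hb : b ∈ T <;> simp [ha, hb]
      _ = μ S := lintegral_indicator_one hS
      _ ≤ c := by
          simp only [c, add_assoc]
          exact le_add_left le_self_add
  · calc ∫⁻ b, essSup (fun a => (S ×ˢ T).indicator 1 (a, b)) μ ∂ν
        ≤ ∫⁻ b, T.indicator 1 b ∂ν := by
          refine lintegral_mono fun b => essSup_le_iff_ae.2 (ae_of_all _ fun a => ?_)
          by_cases ha : a ∈ S <;> by_cases hb : b ∈ T <;> simp [ha, hb]
      _ = ν T := lintegral_indicator_one hT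
      _ ≤ c := by
          simp only [c, add_assoc]
          exact le_add_left (le_add_left le_self_add)

theorem interNorm_eq_mixedInter (μ : Measure α) (ν : Measure β) (f : α × β →ₘ[μ.prod ν] ℂ) :
    interNorm μ ν f = mixedInter μ ν fun p => ‖f p‖ₑ := by
  simp [interNorm, mixedInter, mixedNorm, eLpNorm_one_eq_lintegral_enorm, eLpNormEssSup]

end MixedInter

/-! ### Kernels dominated by a tensor product -/

theorem kernelNormB_lt_top {X₁ X₂ Y₁ Y₂ : Type*} [MeasurableSpace X₁] [MeasurableSpace X₂]
    [MeasurableSpace Y₁] [MeasurableSpace Y₂] (μ₁ : Measure X₁) (μ₂ : Measure X₂)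
    (ν₁ : Measure Y₁) (ν₂ : Measure Y₂)
    [SFinite μ₁] [SFinite μ₂] [SFinite ν₁] [SFinite ν₂]
    {K : (X₁ × X₂) × (Y₁ × Y₂) → ℂ} {G : X₁ × X₂ → ℝ≥0∞} {H : Y₁ × Y₂ → ℝ≥0∞}
    (hG : Measurable G) (hH : Measurable H)
    (hK : ∀ x y, ‖K (x, y)‖ₑ ≤ G x * H y)
    (hG_top : mixedInter μ₁ μ₂ G < ∞) (hH_top : mixedInter ν₁ ν₂ H < ∞) :
    kernelNormB μ₁ μ₂ ν₁ ν₂ K < ∞ := by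
  obtain ⟨hG1, hG2, hG3, hG4⟩ := mixedInter_le_iff.1 (le_refl (mixedInter μ₁ μ₂ G))
  obtain ⟨hH1, hH2, hH3, hH4⟩ := mixedInter_le_iff.1 (le_refl (mixedInter ν₁ ν₂ H))
  set iG := mixedInter μ₁ μ₂ G
  set iH := mixedInter ν₁ ν₂ H
  rw [lintegral_prod_symm' _ hG] at hG1
  rw [lintegral_prod_symm' _ hH] at hH1
  have hGs : ∀ᵐ x₂ ∂μ₂, essSup (fun x₁ => G (x₁, x₂)) μ₁ ≤ iG :=
    (ae_ae_of_ae_prod_right hG2).mono fun _ h => essSup_le_iff_ae.2 h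
  have hHs : ∀ᵐ y₂ ∂ν₂, essSup (fun y₁ => H (y₁, y₂)) ν₁ ≤ iH :=
    (ae_ae_of_ae_prod_right hH2).mono fun _ h => essSup_le_iff_ae.2 h
  have mGs := measurable_essSup_left (μ := μ₁) hG
  have mHs := measurable_essSup_left (μ := ν₁) hH
  have mG : Measurable fun x₂ => ∫⁻ x₁, G (x₁, x₂) ∂μ₁ := hG.lintegral_prod_left'
  have mH : Measurable fun y₂ => ∫⁻ y₁, H (y₁, y₂) ∂ν₁ := hH.lintegral_prod_left'
  -- The maximum in the inner norm is replaced by a sum. Each term is a product of a function of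
  -- `x₂` and one of `y₂`, so the outer norm only sees iterated norms of `G` and `H`.
  have key : ∀ x₂ y₂, kernelNormA μ₁ ν₁ (fun x₁ y₁ => ‖K ((x₁, x₂), (y₁, y₂))‖ₑ) ≤
      essSup (fun x₁ => G (x₁, x₂)) μ₁ * ∫⁻ y₁, H (y₁, y₂) ∂ν₁ +
      (∫⁻ x₁, G (x₁, x₂) ∂μ₁) * essSup (fun y₁ => H (y₁, y₂)) ν₁ := by
    intro x₂ y₂
    refine max_le (le_add_right (essSup_le_iff_ae.2 ?_)) (le_add_left (essSup_le_iff_ae.2 ?_))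
    · filter_upwards [ENNReal.ae_le_essSup (μ := μ₁) fun x₁ => G (x₁, x₂)] with x₁ hx
      refine (lintegral_mono fun y₁ => hK (x₁, x₂) (y₁, y₂)).trans ?_
      rw [lintegral_const_mul _ (by fun_prop)]
      gcongr
    · filter_upwards [ENNReal.ae_le_essSup (μ := ν₁) fun y₁ => H (y₁, y₂)] with y₁ hy
      refine (lintegral_mono fun x₁ => hK (x₁, x₂) (y₁, y₂)).trans ?_
      rw [lintegral_mul_const _ (by fun_prop)]
      gcongr
  have htop : iG * iH + iG * iH < ∞ := by
    simpa using ENNReal.mul_lt_top hG_top hH_top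
  refine lt_of_le_of_lt (max_le (essSup_le_iff_ae.2 ?_) (essSup_le_iff_ae.2 ?_)) htop
  -- The first term pairs `L^∞` of `G` with `L¹` of `H`, the second `L^{1,∞}` of `G` with `L^{∞,1}`
  -- of `H`. The other bullet exchanges the roles, so all four norms of both factors are used.
  · filter_upwards [hGs, hG3] with x₂ h1 h2
    refine (lintegral_mono fun y₂ => key x₂ y₂).trans ?_
    rw [lintegral_add_left (by fun_prop), lintegral_const_mul _ mH, lintegral_const_mul _ mHs]
    gcongr
  · filter_upwards [hHs, hH3] with y₂ h1 h2
    refine (lintegral_mono fun x₂ => key x₂ y₂).trans ?_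
    rw [lintegral_add_left (by fun_prop), lintegral_mul_const _ mG, lintegral_mul_const _ mGs]
    gcongr

/-! ### Measurable selection and thresholds in one variable -/

section Selection

variable {α τ : Type*} [MeasurableSpace α] [MeasurableSpace τ]

/-- Given countably many measurable families `u i` of test functions in the unit ball of
`L¹ ∩ L^∞`, there is one that attains the supremum of the pairings with `F`, up to a factor. -/
theorem exists_measurable_almost_maximizer {ν : Measure α} [SFinite ν] {F : α × τ → ℝ≥0∞}
    (hF : Measurable F) {u : ℕ → α × τ → ℝ≥0∞} (hu : ∀ i, Measurable (u i))
    (hu_le : ∀ i p, u i p ≤ 1) (hu_int : ∀ i t, ∫⁻ a, u i (a, t) ∂ν ≤ 1) :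
    ∃ h : α × τ → ℝ≥0∞, Measurable h ∧ (∀ p, h p ≤ 1) ∧ (∀ t, ∫⁻ a, h (a, t) ∂ν ≤ 1) ∧
      ∀ t, ⨆ i, ∫⁻ a, u i (a, t) * F (a, t) ∂ν ≤ 2 * ∫⁻ a, h (a, t) * F (a, t) ∂ν := by
  classical
  let I : ℕ → τ → ℝ≥0∞ := fun i t => ∫⁻ a, u i (a, t) * F (a, t) ∂ν
  have mI : ∀ i, Measurable (I i) := fun i => ((hu i).mul hF).lintegral_prod_left'
  let S : τ → ℝ≥0∞ := fun t => ⨆ i, I i t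
  have mS : Measurable S := Measurable.iSup mI
  -- Choosing the least index whose pairing reaches `θ t` keeps the selection measurable in `t`.
  have select : ∀ θ : τ → ℝ≥0∞, Measurable θ → (∀ t, ∃ i, θ t ≤ I i t) →
      ∃ h : α × τ → ℝ≥0∞, Measurable h ∧ (∀ p, h p ≤ 1) ∧ (∀ t, ∫⁻ a, h (a, t) ∂ν ≤ 1) ∧
        ∀ t, θ t ≤ ∫⁻ a, h (a, t) * F (a, t) ∂ν := by
    intro θ hθ hex
    refine ⟨fun p => u (Nat.find (hex p.2)) p, ?_, fun p => hu_le _ p, fun t => hu_int (Nat.find (hex t)) t,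
      fun t => Nat.find_spec (hex t)⟩
    exact Measurable.find (p := fun i (p : α × τ) => θ p.2 ≤ I i p.2) hu
      (fun i => measurableSet_le (hθ.comp measurable_snd) ((mI i).comp measurable_snd))
      (fun p => hex p.2)
  -- Half of the supremum is attained only where the supremum is finite; elsewhere the target is the
  -- harmless value `0`.
  obtain ⟨h₀, mh₀, h₀_le, h₀_int, h₀_spec⟩ := select (fun t => if S t = ∞ then 0 else S t / 2)
    (Measurable.ite (mS (measurableSet_singleton _)) measurable_const (mS.div_const 2)) <| by
    intro t
    by_cases hS : S t = ∞
    · exact ⟨0, by simp [hS]⟩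
    by_cases hS0 : S t = 0
    · exact ⟨0, by simp [hS0]⟩
    · simp only [hS, if_false]
      obtain ⟨i, hi⟩ := lt_iSup_iff.1 (ENNReal.half_lt_self hS0 hS)
      exact ⟨i, hi.le⟩
  -- Where the supremum is infinite, members with pairing at least `2 ^ (k + 1)` are summed with
  -- weights `2⁻¹ ^ (k + 1)`: the weights add up to `1`, while each term adds at least `1` to the
  -- pairing.
  have hk := fun k : ℕ => select (fun t => if S t = ∞ then 2 ^ (k + 1) else 0)
    (Measurable.ite (mS (measurableSet_singleton _)) measurable_const measurable_const) <| by
    intro t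
    by_cases hS : S t = ∞
    · have : (2 : ℝ≥0∞) ^ (k + 1) < S t := by simp [hS]
      obtain ⟨i, hi⟩ := lt_iSup_iff.1 this
      exact ⟨i, by simpa [hS] using hi.le⟩
    · exact ⟨0, by simp [hS]⟩
  choose hh mhh hh_le hh_int hh_spec using hk
  have hgeom : ∑' k : ℕ, (2 : ℝ≥0∞)⁻¹ ^ (k + 1) = 1 := ENNReal.tsum_geometric_add_one _ |>.trans (by
    rw [ENNReal.one_sub_inv_two, inv_inv, ENNReal.inv_mul_cancel] <;> simp)
  let h₁ : α × τ → ℝ≥0∞ := fun p => ∑' k, (2 : ℝ≥0∞)⁻¹ ^ (k + 1) * hh k p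
  have mh₁ : Measurable h₁ := Measurable.tsum fun k => (mhh k).const_mul _
  refine ⟨fun p => if S p.2 = ∞ then h₁ p else h₀ p,
    Measurable.ite ((mS.comp measurable_snd) (measurableSet_singleton _)) mh₁ mh₀, ?_, ?_, ?_⟩
  · intro p
    by_cases hS : S p.2 = ∞
    · simp only [hS, if_true, h₁, ← hgeom]
      exact ENNReal.tsum_le_tsum fun k => mul_le_of_le_one_right zero_le (hh_le k p)
    · simpa only [hS, if_false] using h₀_le p
  · intro t
    by_cases hS : S t = ∞
    · simp only [hS, if_true, h₁]
      rw [lintegral_tsum fun k => (by have := mhh k; fun_prop), ← hgeom]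
      refine ENNReal.tsum_le_tsum fun k => ?_
      rw [lintegral_const_mul _ (by have := mhh k; fun_prop)]
      exact mul_le_of_le_one_right zero_le (hh_int k t)
    · simpa only [hS, if_false] using h₀_int t
  · intro t
    by_cases hS : S t = ∞
    · simp only [hS, if_true, h₁, ← ENNReal.tsum_mul_right]
      rw [lintegral_tsum fun k => (by have := mhh k; fun_prop)]
      have : ∑' k, ∫⁻ a, (2 : ℝ≥0∞)⁻¹ ^ (k + 1) * hh k (a, t) * F (a, t) ∂ν = ∞ := by
        rw [eq_top_iff, ← ENNReal.tsum_const_eq_top_of_ne_zero (α := ℕ) one_ne_zero]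
        refine ENNReal.tsum_le_tsum fun k => ?_
        simp only [mul_assoc]
        rw [lintegral_const_mul _ (by have := mhh k; fun_prop)]
        have := hh_spec k t
        simp only [hS, if_true] at this
        calc (1 : ℝ≥0∞) = 2⁻¹ ^ (k + 1) * 2 ^ (k + 1) := by
              rw [← mul_pow, ENNReal.inv_mul_cancel] <;> simp
          _ ≤ _ := by gcongr
      rw [this]
      simp
    · have := h₀_spec t
      simp only [hS, if_false] at this ⊢
      rwa [ENNReal.div_le_iff_le_mul (by simp) (by simp), mul_comm] at this

/-- The threshold `s` controls both the large part of `F` in `L¹` and the remaining part in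
`L^∞`, and is in turn controlled by the pairing of `F` with one test function from the unit
ball of `L¹ ∩ L^∞`. -/
theorem exists_threshold (ν : Measure α) [SigmaFinite ν] {F : α × τ → ℝ≥0∞}
    (hF : Measurable F) :
    ∃ s : τ → ℝ≥0∞, Measurable s ∧ ∃ h : α × τ → ℝ≥0∞, Measurable h ∧ (∀ p, h p ≤ 1) ∧
      (∀ t, ∫⁻ a, h (a, t) ∂ν ≤ 1) ∧ (∀ t, s t ≤ 2 * ∫⁻ a, h (a, t) * F (a, t) ∂ν) ∧
      ∀ t, ∫⁻ a in {a | s t < F (a, t)}, F (a, t) ∂ν ≤ s t := by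
  classical
  obtain ⟨e, he⟩ := exists_surjective_nat (ℚ × ℕ)
  let r : ℚ → ℝ≥0∞ := fun q => ENNReal.ofReal q
  let L : ℚ × ℕ → τ → Set α := fun j t => {a | r j.1 < F (a, t)} ∩ spanningSets ν j.2
  have mL : ∀ j, MeasurableSet {p : α × τ | p.1 ∈ L j p.2} := fun j =>
    (measurableSet_lt measurable_const hF).inter
      (measurable_fst (measurableSet_spanningSets ν j.2))
  have mL' : ∀ j t, MeasurableSet (L j t) := fun j t => measurable_prodMk_right (mL j)
  have mνL : ∀ j, Measurable fun t => ν (L j t) := fun j => measurable_measure_prodMk_right (mL j)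
  -- Superlevel sets cut to finite measure, normalised to lie in the unit balls of `L¹` and `L^∞` at
  -- once. Rational levels keep the family countable.
  let u : ℚ × ℕ → α × τ → ℝ≥0∞ := fun j p =>
    {p : α × τ | p.1 ∈ L j p.2}.indicator (fun p => (max 1 (ν (L j p.2)))⁻¹) p
  have u_eq : ∀ j t a, u j (a, t) = (L j t).indicator (fun _ => (max 1 (ν (L j t)))⁻¹) a :=
    fun j t a => rfl
  have mu : ∀ j, Measurable (u j) := fun j =>
    (measurable_const.max ((mνL j).comp measurable_snd)).inv.indicator (mL j)
  have u_mul : ∀ j t, ∫⁻ a, u j (a, t) * F (a, t) ∂ν =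
      (max 1 (ν (L j t)))⁻¹ * ∫⁻ a in L j t, F (a, t) ∂ν := by
    intro j t
    rw [← lintegral_indicator (mL' j t), ← lintegral_const_mul _ (by
      exact (hF.comp measurable_prodMk_right).indicator (mL' j t))]
    refine lintegral_congr fun a => ?_
    by_cases ha : a ∈ L j t <;> simp [u_eq, ha]
  obtain ⟨h, mh, h_le, h_int, h_spec⟩ := exists_measurable_almost_maximizer (ν := ν) hF
    (u := fun i => u (e i)) (fun i => mu _)
    (fun i p => Set.indicator_apply_le' (fun _ => by simp [ENNReal.inv_le_one]) (fun _ => zero_le))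
    (fun i t => by
      simp only [u_eq]
      rw [lintegral_indicator_const (mL' _ t)]
      exact (ENNReal.div_eq_inv_mul ..).symm.trans_le <| ENNReal.div_le_of_le_mul (by simp))
  let s : τ → ℝ≥0∞ := fun t => ⨆ i, ∫⁻ a, u (e i) (a, t) * F (a, t) ∂ν
  have le_s : ∀ j t, (max 1 (ν (L j t)))⁻¹ * ∫⁻ a in L j t, F (a, t) ∂ν ≤ s t := by
    intro j t
    obtain ⟨i, rfl⟩ := he j
    rw [← u_mul]
    exact le_iSup (fun i => ∫⁻ a, u (e i) (a, t) * F (a, t) ∂ν) i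
  refine ⟨s, Measurable.iSup fun i => ((mu _).mul hF).lintegral_prod_left', h, mh, h_le, h_int,
    h_spec, fun t => ?_⟩
  -- On a set of measure above `1` the pairing with `u` is the average of `F`, which is at least the
  -- level `r q`; but all these pairings are at most `s t < r q`.
  have small : ∀ q : ℚ, s t < r q → ∀ n, ν (L (q, n) t) ≤ 1 := by
    intro q hq n
    by_contra! hlt
    have hfin : ν (L (q, n) t) ≠ ∞ :=
      (measure_mono Set.inter_subset_right |>.trans_lt (measure_spanningSets_lt_top ν n)).ne
    refine hq.not_ge (le_trans ?_ (le_s (q, n) t))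
    rw [max_eq_right hlt.le, ← ENNReal.div_eq_inv_mul,
      ENNReal.le_div_iff_mul_le (Or.inl (zero_lt_one.trans hlt).ne') (Or.inl hfin),
      ← setLIntegral_const]
    exact setLIntegral_mono' (mL' _ t) fun a ha => le_of_lt ha.1
  have hunion : {a | s t < F (a, t)} = ⋃ j : {j : ℚ × ℕ // s t < r j.1}, L j.1 t := by
    ext a
    simp only [Set.mem_ofPred_eq, Set.mem_iUnion]
    constructor
    · intro ha
      obtain ⟨q, -, h1, h2⟩ := ENNReal.lt_iff_exists_rat_btwn.1 ha
      have : a ∈ ⋃ n, spanningSets ν n := by simp [iUnion_spanningSets]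
      obtain ⟨n, hn⟩ := Set.mem_iUnion.1 this
      exact ⟨⟨(q, n), h1⟩, h2, hn⟩
    · rintro ⟨⟨⟨q, n⟩, hq⟩, ha, -⟩
      exact hq.trans ha
  have hdir : Directed (· ⊆ ·) fun j : {j : ℚ × ℕ // s t < r j.1} => L j.1 t := by
    rintro ⟨⟨q, n⟩, hq⟩ ⟨⟨q', n'⟩, hq'⟩
    refine ⟨⟨(min q q', max n n'), ?_⟩, ?_, ?_⟩
    · rcases min_choice q q' with h | h <;> simpa only [h]
    · exact Set.inter_subset_inter (fun a ha => lt_of_le_of_lt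
        (ENNReal.ofReal_le_ofReal (by exact_mod_cast min_le_left q q')) ha)
        (monotone_spanningSets ν (le_max_left _ _))
    · exact Set.inter_subset_inter (fun a ha => lt_of_le_of_lt
        (ENNReal.ofReal_le_ofReal (by exact_mod_cast min_le_right q q')) ha)
        (monotone_spanningSets ν (le_max_right _ _))
  have mlevel : MeasurableSet {a | s t < F (a, t)} :=
    measurableSet_lt measurable_const (by fun_prop)
  -- Read as a measure with density `F`, the integral over the directed union is the supremum of the
  -- integrals over sets of measure at most `1`, where the normalising factor of `u` is `1`.
  rw [← withDensity_apply _ mlevel, hunion, hdir.measure_iUnion]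
  refine iSup_le fun j => ?_
  rw [withDensity_apply _ (mL' _ t)]
  simpa [max_eq_left (small j.1.1 j.2 j.1.2)] using le_s j.1 t

end Selection

/-! ### Splitting into the four summands -/

section SumNorm

variable {α β : Type*} [MeasurableSpace α] [MeasurableSpace β]

theorem mixedNorm_congr_ae {μ : Measure α} {ν : Measure β} [SFinite μ] [SFinite ν]
    (p q : ℝ≥0∞) {f g : α × β → ℂ} (h : f =ᵐ[μ.prod ν] g) :
    mixedNorm p q μ ν f = mixedNorm p q μ ν g :=
  eLpNorm_congr_ae <| (ae_ae_of_ae_prod_right h).mono fun _ hb => eLpNorm_congr_ae hb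

/-- The class of a measurable function, cut off to a measurable set. -/
def cutoff {Ω : Type*} [MeasurableSpace Ω] {μ : Measure Ω} (φ : Ω →ₘ[μ] ℂ) (D : Set Ω)
    (hD : MeasurableSet D) : Ω →ₘ[μ] ℂ :=
  AEEqFun.mk (D.indicator φ) (φ.measurable.indicator hD).aestronglyMeasurable

theorem coeFn_cutoff {Ω : Type*} [MeasurableSpace Ω] {μ : Measure Ω} (φ : Ω →ₘ[μ] ℂ) {D : Set Ω}
    (hD : MeasurableSet D) : cutoff φ D hD =ᵐ[μ] D.indicator φ :=
  AEEqFun.coeFn_mk _ _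

/-- The norm of `L¹ + L^∞ + L^{1,∞} + L^{∞,1}` is controlled by the pairing with a single element
of the unit ball of `L¹ ∩ L^∞ ∩ L^{1,∞} ∩ L^{∞,1}`. -/
theorem exists_sumNorm_le_pairing (μ : Measure α) (ν : Measure β) [SigmaFinite μ] [SigmaFinite ν]
    (φ : α × β →ₘ[μ.prod ν] ℂ) :
    ∃ g : α × β → ℝ≥0∞, Measurable g ∧ mixedInter μ ν g ≤ 1 ∧
      sumNorm μ ν φ ≤ 16 * ∫⁻ p, g p * ‖φ p‖ₑ ∂μ.prod ν := by
  have mF : Measurable fun p => ‖φ p‖ₑ := φ.measurable.enorm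
  obtain ⟨s, ms, h, mh, h_le, h_int, h_spec, s_spec⟩ := exists_threshold μ mF
  -- The second threshold is a single number, so the parameter space is `Unit`.
  obtain ⟨σ', -, k', mk', k_le, k_int, k_spec, σ_spec⟩ := exists_threshold ν
    (F := fun p : β × Unit => s p.1) (ms.comp measurable_fst)
  generalize hσ : σ' () = σ
  let k : β → ℝ≥0∞ := fun b => k' (b, ())
  have mk : Measurable k := by fun_prop
  replace k_le : ∀ b, k b ≤ 1 := fun b => k_le _
  replace k_int : ∫⁻ b, k b ∂ν ≤ 1 := k_int ()
  replace k_spec : σ ≤ 2 * ∫⁻ b, k b * s b ∂ν := hσ ▸ k_spec ()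
  replace σ_spec : ∫⁻ b in {b | σ < s b}, s b ∂ν ≤ σ := hσ ▸ σ_spec ()
  have hsup : ∀ b, essSup (fun a => h (a, b) * k b) μ ≤ k b := fun b =>
    essSup_le_iff_ae.2 (ae_of_all _ fun a => mul_le_of_le_one_left zero_le (h_le _))
  have hint : ∀ b, ∫⁻ a, h (a, b) * k b ∂μ ≤ k b := fun b => by
    rw [lintegral_mul_const _ (by fun_prop)]
    exact mul_le_of_le_one_left zero_le (h_int b)
  refine ⟨fun p => h p * k p.2, by fun_prop, mixedInter_le_iff.2 ⟨?_, ?_, ?_, ?_⟩, ?_⟩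
  · rw [lintegral_prod_symm' _ (by fun_prop)]
    exact (lintegral_mono hint).trans k_int
  · exact ae_of_all _ fun p => mul_le_one' (h_le p) (k_le _)
  · exact ae_of_all _ fun b => (hint b).trans (k_le b)
  · exact (lintegral_mono hsup).trans k_int
  -- Each of the two thresholds costs a factor `2`; the four pieces below, each of norm at most `σ`,
  -- bring the constant to `16`.
  have pairing : σ ≤ 4 * ∫⁻ p, h p * k p.2 * ‖φ p‖ₑ ∂μ.prod ν := by
    rw [lintegral_prod_symm' _ (by fun_prop)]
    calc σ ≤ 2 * ∫⁻ b, k b * s b ∂ν := k_spec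
      _ ≤ 2 * ∫⁻ b, k b * (2 * ∫⁻ a, h (a, b) * ‖φ (a, b)‖ₑ ∂μ) ∂ν := by
          gcongr with b
          exact h_spec b
      _ = 2 * ∫⁻ b, 2 * ∫⁻ a, h (a, b) * k b * ‖φ (a, b)‖ₑ ∂μ ∂ν := by
          congr 1
          refine lintegral_congr fun b => ?_
          rw [mul_left_comm, ← lintegral_const_mul _ (by fun_prop)]
          simp only [mul_assoc, mul_left_comm (k b)]
      _ = _ := by
          rw [lintegral_const_mul _ (Measurable.lintegral_prod_left'
            (f := fun p : α × β => h p * k p.2 * ‖φ p‖ₑ) (by fun_prop)), ← mul_assoc]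
          norm_num
  suffices sumNorm μ ν φ ≤ 4 * σ by
    refine this.trans ((mul_le_mul_right pairing 4).trans_eq ?_)
    rw [← mul_assoc]
    norm_num
  have mP : MeasurableSet {p : α × β | σ < s p.2} := measurableSet_lt (by fun_prop) (by fun_prop)
  have mQ : MeasurableSet {p : α × β | s p.2 < ‖φ p‖ₑ} := measurableSet_lt (by fun_prop) mF
  set P := {p : α × β | σ < s p.2}
  set Q := {p : α × β | s p.2 < ‖φ p‖ₑ}
  -- On `Q` the slice integral of `|φ|` is at most `s`, off `Q` one has `|φ| ≤ s`; on `P` the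
  -- integral of `s` is at most `σ`, off `P` one has `s ≤ σ`. The four combinations give the `L¹`,
  -- `L^∞`, `L^{1,∞}` and `L^{∞,1}` pieces.
  have hdec : φ = cutoff φ (P ∩ Q) (mP.inter mQ) + cutoff φ (Pᶜ ∩ Qᶜ) (mP.compl.inter mQ.compl)
      + cutoff φ (Pᶜ ∩ Q) (mP.compl.inter mQ) + cutoff φ (P ∩ Qᶜ) (mP.inter mQ.compl) := by
    refine AEEqFun.ext ?_
    filter_upwards [AEEqFun.coeFn_add (cutoff φ (P ∩ Q) (mP.inter mQ) +
        cutoff φ (Pᶜ ∩ Qᶜ) (mP.compl.inter mQ.compl) + cutoff φ (Pᶜ ∩ Q) (mP.compl.inter mQ))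
        (cutoff φ (P ∩ Qᶜ) (mP.inter mQ.compl)),
      AEEqFun.coeFn_add (cutoff φ (P ∩ Q) (mP.inter mQ) +
        cutoff φ (Pᶜ ∩ Qᶜ) (mP.compl.inter mQ.compl)) (cutoff φ (Pᶜ ∩ Q) (mP.compl.inter mQ)),
      AEEqFun.coeFn_add (cutoff φ (P ∩ Q) (mP.inter mQ))
        (cutoff φ (Pᶜ ∩ Qᶜ) (mP.compl.inter mQ.compl)),
      coeFn_cutoff φ (mP.inter mQ), coeFn_cutoff φ (mP.compl.inter mQ.compl),
      coeFn_cutoff φ (mP.compl.inter mQ), coeFn_cutoff φ (mP.inter mQ.compl)]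
      with p h1 h2 h3 h4 h5 h6 h7
    rw [h1, Pi.add_apply, h2, Pi.add_apply, h3, Pi.add_apply, h4, h5, h6, h7]
    by_cases hp : p ∈ P <;> by_cases hq : p ∈ Q <;> simp [hp, hq]
  refine iInf_le_of_le (cutoff φ (P ∩ Q) (mP.inter mQ)) <|
    iInf_le_of_le (cutoff φ (Pᶜ ∩ Qᶜ) (mP.compl.inter mQ.compl)) <|
    iInf_le_of_le (cutoff φ (Pᶜ ∩ Q) (mP.compl.inter mQ)) <|
    iInf_le_of_le (cutoff φ (P ∩ Qᶜ) (mP.inter mQ.compl)) <| iInf_le_of_le hdec ?_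
  have large : ∀ b, ∫⁻ a, ‖Q.indicator φ (a, b)‖ₑ ∂μ ≤ s b := fun b => by
    refine le_trans (le_of_eq ?_) (s_spec b)
    rw [← lintegral_indicator (measurableSet_lt (by fun_prop) (by fun_prop))]
    refine lintegral_congr fun a => ?_
    by_cases hq : s b < ‖φ (a, b)‖ₑ <;> simp [Q, hq]
  have inter_le : ∀ (D : Set (α × β)) p, ‖(D ∩ Q).indicator φ p‖ₑ ≤ ‖Q.indicator φ p‖ₑ := by
    intro D p
    by_cases hp : p ∈ D <;> by_cases hq : p ∈ Q <;> simp [hp, hq]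
  have b1 : eLpNorm (cutoff φ (P ∩ Q) (mP.inter mQ)) 1 (μ.prod ν) ≤ σ := by
    rw [eLpNorm_congr_ae (coeFn_cutoff φ _), eLpNorm_one_eq_lintegral_enorm,
      lintegral_prod_symm' _ (φ.measurable.indicator (mP.inter mQ)).enorm]
    refine le_trans ?_ σ_spec
    rw [← lintegral_indicator (measurableSet_lt (by fun_prop) ms)]
    refine lintegral_mono fun b => ?_
    by_cases hb : σ < s b
    · rw [Set.indicator_of_mem (show b ∈ {b | σ < s b} from hb)]
      exact (lintegral_mono fun a => inter_le P (a, b)).trans (large b)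
    · have : ∀ a, (a, b) ∉ P ∩ Q := fun a ha => hb ha.1
      simp [this]
  have b2 : eLpNorm (cutoff φ (Pᶜ ∩ Qᶜ) (mP.compl.inter mQ.compl)) ∞ (μ.prod ν) ≤ σ := by
    rw [eLpNorm_congr_ae (coeFn_cutoff φ _), eLpNorm_exponent_top]
    refine essSup_le_iff_ae.2 (ae_of_all _ fun p => ?_)
    by_cases hp : p ∈ Pᶜ ∩ Qᶜ
    · have h1 : ¬ σ < s p.2 := hp.1
      have h2 : ¬ s p.2 < ‖φ p‖ₑ := hp.2
      simpa [hp] using (not_lt.1 h2).trans (not_lt.1 h1)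
    · simp [Set.indicator_of_notMem hp]
  have b3 : mixedNorm 1 ∞ μ ν (cutoff φ (Pᶜ ∩ Q) (mP.compl.inter mQ)) ≤ σ := by
    rw [mixedNorm_congr_ae _ _ (coeFn_cutoff φ _), mixedNorm, eLpNorm_exponent_top]
    refine essSup_le_iff_ae.2 (ae_of_all _ fun b => ?_)
    simp only [enorm_eq_self, eLpNorm_one_eq_lintegral_enorm]
    by_cases hb : σ < s b
    · have : ∀ a, (a, b) ∉ Pᶜ ∩ Q := fun a ha => ha.1 hb
      simp [this]
    · exact (lintegral_mono fun a => inter_le _ (a, b)).trans ((large b).trans (not_lt.1 hb))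
  have b4 : mixedNorm ∞ 1 μ ν (cutoff φ (P ∩ Qᶜ) (mP.inter mQ.compl)) ≤ σ := by
    rw [mixedNorm_congr_ae _ _ (coeFn_cutoff φ _), mixedNorm, eLpNorm_one_eq_lintegral_enorm]
    refine le_trans ?_ σ_spec
    rw [← lintegral_indicator (measurableSet_lt (by fun_prop) ms)]
    refine lintegral_mono fun b => ?_
    rw [enorm_eq_self, eLpNorm_exponent_top]
    refine essSup_le_iff_ae.2 (ae_of_all _ fun a => ?_)
    by_cases hp : (a, b) ∈ P ∩ Qᶜ
    · have h1 : σ < s b := hp.1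
      have h2 : ¬ s b < ‖φ (a, b)‖ₑ := hp.2
      simpa [hp, h1] using not_lt.1 h2
    · simp [Set.indicator_of_notMem hp]
  calc _ ≤ σ + σ + σ + σ := by gcongr
    _ = 4 * σ := by ring

end SumNorm

/-! ### Gliding hump and domination in solid Banach function spaces -/

section Domination

variable {Ω : Type*} [MeasurableSpace Ω] {μ : Measure Ω}

/-- A gliding hump argument: if every rapidly decreasing sequence of a function space is dominated
by a single element of it, then each monotone homogeneous functional on it is bounded. -/
theorem exists_bound_of_dominated {A : FunctionSpace μ} {ρ : (Ω →ₘ[μ] ℂ) → ℝ}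
    (norm_nonneg : ∀ f ∈ A.carrier, 0 ≤ A.norm f)
    (smul_mem : ∀ c : ℂ, ∀ f ∈ A.carrier, c • f ∈ A.carrier)
    (norm_smul_le : ∀ c : ℂ, ∀ f ∈ A.carrier, A.norm (c • f) ≤ ‖c‖ * A.norm f)
    (le_smul : ∀ c : ℝ, 0 ≤ c → ∀ f ∈ A.carrier, c * ρ f ≤ ρ ((c : ℂ) • f))
    (mono : ∀ f ∈ A.carrier, ∀ g ∈ A.carrier, (∀ᵐ x ∂μ, ‖f x‖ ≤ ‖g x‖) → ρ f ≤ ρ g)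
    (dominated : ∀ e : ℕ → (Ω →ₘ[μ] ℂ), (∀ n, e n ∈ A.carrier) →
      (∀ n, A.norm (e n) ≤ (1 / 2 : ℝ) ^ n) →
      ∃ g ∈ A.carrier, ∀ n, ∀ᵐ x ∂μ, ‖e n x‖ ≤ ‖g x‖) :
    ∃ c : ℝ, ∀ f ∈ A.carrier, ρ f ≤ c * A.norm f := by
  by_contra! H
  choose f hf hlt using fun n : ℕ => H (n * 2 ^ n)
  -- The factor `n * 2 ^ n` allows rescaling `f n` to norm at most `2⁻ⁿ` while `ρ` stays at least
  -- `n`; a common dominating element would then have `ρ` above every `n`. If `f n` has norm `0`,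
  -- any multiple is allowed.
  have scale : ∀ n, ∃ a : ℝ, 0 ≤ a ∧ a * A.norm (f n) ≤ (1 / 2 : ℝ) ^ n ∧ n ≤ a * ρ (f n) := by
    intro n
    rcases (norm_nonneg _ (hf n)).eq_or_lt with h0 | h0
    · have hpos : 0 < ρ (f n) := by simpa [← h0] using hlt n
      refine ⟨n / ρ (f n), by positivity, ?_, ?_⟩
      · rw [← h0, mul_zero]
        positivity
      · rw [div_mul_cancel₀ _ hpos.ne']
    · refine ⟨(1 / 2) ^ n / A.norm (f n), by positivity, ?_, ?_⟩
      · rw [div_mul_cancel₀ _ h0.ne']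
      · calc (n : ℝ) = (1 / 2) ^ n / A.norm (f n) * (n * 2 ^ n * A.norm (f n)) := by
              rw [← mul_assoc, div_mul_eq_mul_div, div_mul_cancel₀ _ h0.ne', mul_left_comm, ← mul_pow]
              norm_num
          _ ≤ _ := by
              gcongr
              exact (hlt n).le
  choose a ha0 ha1 ha2 using scale
  obtain ⟨g, hg, hge⟩ := dominated (fun n => (a n : ℂ) • f n) (fun n => smul_mem _ _ (hf n))
    (fun n => (norm_smul_le _ _ (hf n)).trans (by
      rw [Complex.norm_real, Real.norm_of_nonneg (ha0 n)]
      exact ha1 n))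
  obtain ⟨n, hn⟩ := exists_nat_gt (ρ g)
  refine hn.not_ge ?_
  exact ((ha2 n).trans (le_smul _ (ha0 n) _ (hf n))).trans
    (mono _ (smul_mem _ _ (hf n)) _ hg (hge n))

/-- The class of `|f|`. -/
def absClass (f : Ω →ₘ[μ] ℂ) : Ω →ₘ[μ] ℂ :=
  AEEqFun.mk (fun x => (‖f x‖ : ℂ))
    (Complex.measurable_ofReal.comp f.measurable.norm).aestronglyMeasurable

theorem coeFn_absClass (f : Ω →ₘ[μ] ℂ) : ∀ᵐ x ∂μ, absClass f x = (‖f x‖ : ℂ) :=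
  AEEqFun.coeFn_mk _ _

theorem FunctionSpace.IsSolidBanach.absClass_mem {A : FunctionSpace μ} (hA : A.IsSolidBanach)
    {f : Ω →ₘ[μ] ℂ} (hf : f ∈ A.carrier) :
    absClass f ∈ A.carrier ∧ A.norm (absClass f) ≤ A.norm f :=
  hA.solid f hf _ ((coeFn_absClass f).mono fun x hx => by simp [hx])

theorem FunctionSpace.IsSolidBanach.norm_sub_comm {A : FunctionSpace μ} (hA : A.IsSolidBanach)
    {f g : Ω →ₘ[μ] ℂ} (hf : f ∈ A.carrier) (hg : g ∈ A.carrier) :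
    f - g ∈ A.carrier ∧ A.norm (f - g) = A.norm (g - f) := by
  have neg_one_smul : ∀ h : Ω →ₘ[μ] ℂ, (-1 : ℂ) • h = -h := fun h => by
    refine AEEqFun.ext ?_
    filter_upwards [AEEqFun.coeFn_smul (-1 : ℂ) h, AEEqFun.coeFn_neg h] with x h1 h2
    rw [h1, h2, Pi.smul_apply, Pi.neg_apply, smul_eq_mul, neg_one_mul]
  have sub_mem : ∀ f ∈ A.carrier, ∀ g ∈ A.carrier, f - g ∈ A.carrier := fun f hf g hg => by
    have := hA.add_mem f hf _ (hA.smul_mem (-1) g hg)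
    rwa [neg_one_smul, ← sub_eq_add_neg] at this
  refine ⟨sub_mem f hf g hg, ?_⟩
  have := hA.norm_smul (-1) (g - f) (sub_mem g hg f hf)
  rwa [neg_one_smul, neg_sub, norm_neg, norm_one, one_mul] at this

/-- The dominating element is the norm limit of the partial sums of `|e i|`. Domination is read off
from solidity, without almost everywhere convergent subsequences. -/
theorem FunctionSpace.IsSolidBanach.dominated {A : FunctionSpace μ} (hA : A.IsSolidBanach)
    (e : ℕ → (Ω →ₘ[μ] ℂ)) (he : ∀ n, e n ∈ A.carrier)
    (he_norm : ∀ n, A.norm (e n) ≤ (1 / 2 : ℝ) ^ n) :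
    ∃ g ∈ A.carrier, ∀ n, ∀ᵐ x ∂μ, ‖e n x‖ ≤ ‖g x‖ := by
  let u : ℕ → (Ω →ₘ[μ] ℂ) := fun k => ∑ i ∈ Finset.range k, absClass (e i)
  have u_succ : ∀ k, u (k + 1) = u k + absClass (e k) := fun k => Finset.sum_range_succ _ _
  have u_mem : ∀ k, u k ∈ A.carrier := by
    intro k
    induction k with
    | zero => simpa [u] using hA.zero_mem
    | succ k ih => exact u_succ k ▸ hA.add_mem _ ih _ (hA.absClass_mem (he k)).1
  have u_coe : ∀ k, ∀ᵐ x ∂μ, u k x = ((∑ i ∈ Finset.range k, ‖e i x‖ : ℝ) : ℂ) := by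
    intro k
    induction k with
    | zero =>
      filter_upwards [AEEqFun.coeFn_zero (μ := μ) (α := Ω) (β := ℂ)] with x hx
      simpa [u] using hx
    | succ k ih =>
      filter_upwards [ih, AEEqFun.coeFn_add (u k) (absClass (e k)), coeFn_absClass (e k)]
        with x h1 h2 h3
      rw [u_succ, h2, Pi.add_apply, h1, h3, Finset.sum_range_succ, Complex.ofReal_add]
  have u_sub : ∀ n j, A.norm (u (n + j) - u n) ≤ 2 * (1 / 2 : ℝ) ^ n - 2 * (1 / 2) ^ (n + j) := by
    intro n j
    induction j with
    | zero =>
      have := (hA.norm_eq_zero_iff 0 hA.zero_mem).2 rfl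
      simp [this]
    | succ j ih =>
      have h1 := hA.norm_add_le _ (hA.norm_sub_comm (u_mem (n + j)) (u_mem n)).1 _
        (hA.absClass_mem (he (n + j))).1
      have h2 := (hA.absClass_mem (he (n + j))).2.trans (he_norm (n + j))
      rw [← add_assoc, u_succ, add_sub_right_comm, pow_succ]
      linarith
  have cauchy : ∀ ε > 0, ∃ N, ∀ k ≥ N, ∀ n ≥ N, A.norm (u k - u n) < ε := by
    intro ε hε
    obtain ⟨N, hN⟩ := exists_pow_lt_of_lt_one (half_pos hε) (by norm_num : (1 / 2 : ℝ) < 1)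
    have main : ∀ n ≥ N, ∀ k ≥ n, A.norm (u k - u n) < ε := by
      intro n hn k hk
      obtain ⟨j, rfl⟩ := Nat.exists_eq_add_of_le hk
      have h1 := u_sub n j
      have h2 : (1 / 2 : ℝ) ^ n ≤ (1 / 2) ^ N :=
        pow_le_pow_of_le_one (by norm_num) (by norm_num) hn
      have h3 : (0 : ℝ) < (1 / 2) ^ (n + j) := by positivity
      linarith
    refine ⟨N, fun k hk n hn => ?_⟩
    rcases le_total n k with h | h
    · exact main n hn k h
    · rw [(hA.norm_sub_comm (u_mem k) (u_mem n)).2]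
      exact main k hk n h
  obtain ⟨g, hg, hlim⟩ := hA.complete u u_mem cauchy
  refine ⟨g, hg, fun n => ?_⟩
  -- The excess of `|e n|` over `|g|` is dominated by `|u k - g|` for every `k > n`, so its norm is
  -- `0`.
  let d : Ω →ₘ[μ] ℂ := AEEqFun.mk (fun x => ((max (‖e n x‖ - ‖g x‖) 0 : ℝ) : ℂ))
    (Complex.measurable_ofReal.comp (((e n).measurable.norm.sub g.measurable.norm).max
      measurable_const)).aestronglyMeasurable
  have d_coe : ∀ᵐ x ∂μ, d x = ((max (‖e n x‖ - ‖g x‖) 0 : ℝ) : ℂ) := AEEqFun.coeFn_mk _ _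
  have d_le : ∀ k ≥ n + 1, d ∈ A.carrier ∧ A.norm d ≤ A.norm (u k - g) := by
    intro k hk
    refine hA.solid _ (hA.norm_sub_comm (u_mem k) hg).1 d ?_
    filter_upwards [d_coe, u_coe k, AEEqFun.coeFn_sub (u k) g] with x h1 h2 h3
    rw [h1, h3, Pi.sub_apply, Complex.norm_real, Real.norm_of_nonneg (le_max_right _ _)]
    refine max_le ?_ (_root_.norm_nonneg _)
    have h4 : ‖e n x‖ ≤ ‖u k x‖ := by
      rw [h2, Complex.norm_real, Real.norm_of_nonneg (by positivity)]
      exact Finset.single_le_sum (f := fun i => ‖e i x‖) (fun i _ => _root_.norm_nonneg _)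
        (Finset.mem_range.2 hk)
    linarith [norm_sub_norm_le (u k x) (g x)]
  have d_mem := (d_le (n + 1) le_rfl).1
  have d_norm : A.norm d = 0 := by
    refine le_antisymm (ge_of_tendsto hlim ?_) (hA.norm_nonneg d d_mem)
    exact eventually_atTop.2 ⟨n + 1, fun k hk => (d_le k hk).2⟩
  have d_zero : d = 0 := (hA.norm_eq_zero_iff d d_mem).1 d_norm
  filter_upwards [d_coe, d_zero ▸ AEEqFun.coeFn_zero (μ := μ) (α := Ω) (β := ℂ)] with x h1 h2
  rw [h2, Pi.zero_apply, eq_comm, Complex.ofReal_eq_zero] at h1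
  have := (le_max_left (‖e n x‖ - ‖g x‖) 0).trans_eq h1
  linarith

theorem coeFn_weight_mul {v : Ω → ℝ} (hv : Measurable v) (f : Ω →ₘ[μ] ℂ) :
    ∀ᵐ x ∂μ, ((AEEqFun.mk (fun x => (v x : ℂ))
      (Complex.measurable_ofReal.comp hv).aestronglyMeasurable * f : Ω →ₘ[μ] ℂ) : Ω → ℂ) x = v x * f x := by
  filter_upwards [AEEqFun.coeFn_mul (AEEqFun.mk (fun x => (v x : ℂ))
    (Complex.measurable_ofReal.comp hv).aestronglyMeasurable) f,
    AEEqFun.coeFn_mk (fun x => (v x : ℂ))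
      (Complex.measurable_ofReal.comp hv).aestronglyMeasurable (μ := μ)] with x h1 h2
  rw [h1, Pi.mul_apply, h2]

end Domination

/-! ### The weighted intersection space -/

section WeightedInter

variable {α β : Type*} [MeasurableSpace α] [MeasurableSpace β]
  {μ : Measure α} {ν : Measure β} [SFinite μ] [SFinite ν]

theorem interNorm_weight_mul {v : α × β → ℝ} (hv : Measurable v) (f : α × β →ₘ[μ.prod ν] ℂ) :
    interNorm μ ν (AEEqFun.mk (fun x => (v x : ℂ))
      (Complex.measurable_ofReal.comp hv).aestronglyMeasurable * f) =
      mixedInter μ ν fun x => ‖(v x : ℂ) * f x‖ₑ := by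
  rw [interNorm_eq_mixedInter]
  have h := coeFn_weight_mul hv f
  exact le_antisymm (mixedInter_mono_ae (h.mono fun x hx => by rw [hx]))
    (mixedInter_mono_ae (h.mono fun x hx => by rw [hx]))

theorem mem_weighted_interSpace {v : α × β → ℝ} (hv : Measurable v) {f : α × β →ₘ[μ.prod ν] ℂ} :
    f ∈ ((interSpace μ ν).weighted v hv).carrier ↔
      mixedInter μ ν (fun x => ‖(v x : ℂ) * f x‖ₑ) < ∞ := by
  rw [← interNorm_weight_mul hv]
  rfl

theorem norm_weighted_interSpace {v : α × β → ℝ} (hv : Measurable v)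
    (f : α × β →ₘ[μ.prod ν] ℂ) :
    ((interSpace μ ν).weighted v hv).norm f =
      (mixedInter μ ν (fun x => ‖(v x : ℂ) * f x‖ₑ)).toReal := by
  rw [← interNorm_weight_mul hv]
  rfl

theorem weighted_interSpace_smul {v : α × β → ℝ} (hv : Measurable v) (c : ℂ)
    {f : α × β →ₘ[μ.prod ν] ℂ} (hf : f ∈ ((interSpace μ ν).weighted v hv).carrier) :
    c • f ∈ ((interSpace μ ν).weighted v hv).carrier ∧
      ((interSpace μ ν).weighted v hv).norm (c • f) ≤
        ‖c‖ * ((interSpace μ ν).weighted v hv).norm f := by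
  rw [mem_weighted_interSpace] at hf
  have mf : Measurable fun x => ‖(v x : ℂ) * f x‖ₑ := by
    have := f.measurable
    fun_prop
  have hle : mixedInter μ ν (fun x => ‖(v x : ℂ) * (c • f) x‖ₑ) ≤
      ‖c‖ₑ * mixedInter μ ν (fun x => ‖(v x : ℂ) * f x‖ₑ) := by
    refine (mixedInter_mono_ae ?_).trans (mixedInter_const_mul_le mf ‖c‖ₑ)
    filter_upwards [AEEqFun.coeFn_smul c f] with x hx
    rw [hx, Pi.smul_apply, smul_eq_mul, mul_left_comm, enorm_mul]
  have htop : ‖c‖ₑ * mixedInter μ ν (fun x => ‖(v x : ℂ) * f x‖ₑ) < ∞ :=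
    ENNReal.mul_lt_top enorm_lt_top hf
  refine ⟨(mem_weighted_interSpace hv).2 (hle.trans_lt htop), ?_⟩
  rw [norm_weighted_interSpace, norm_weighted_interSpace, ← toReal_enorm c, ← ENNReal.toReal_mul]
  exact ENNReal.toReal_mono htop.ne hle

/-- The sum of the weighted moduli has finite norm by countable subadditivity, so it can be divided
by `v` and used directly; completeness of the space is not needed. -/
theorem weighted_interSpace_dominated {v : α × β → ℝ} (hv : Measurable v) (hv_pos : ∀ x, 0 < v x)
    (e : ℕ → (α × β →ₘ[μ.prod ν] ℂ))
    (he : ∀ n, e n ∈ ((interSpace μ ν).weighted v hv).carrier)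
    (he_norm : ∀ n, ((interSpace μ ν).weighted v hv).norm (e n) ≤ (1 / 2 : ℝ) ^ n) :
    ∃ g ∈ ((interSpace μ ν).weighted v hv).carrier, ∀ n, ∀ᵐ x ∂μ.prod ν, ‖e n x‖ ≤ ‖g x‖ := by
  let G : ℕ → α × β → ℝ≥0∞ := fun n x => ‖(v x : ℂ) * e n x‖ₑ
  have mG : ∀ n, Measurable (G n) := fun n => by
    have := (e n).measurable
    fun_prop
  let S : α × β → ℝ≥0∞ := fun x => ∑' n, G n x
  have mS : Measurable S := Measurable.tsum mG
  have hS : mixedInter μ ν S < ∞ := by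
    calc mixedInter μ ν S ≤ ∑' n, mixedInter μ ν (G n) := mixedInter_tsum_le mG
      _ ≤ ∑' n : ℕ, (2 : ℝ≥0∞)⁻¹ ^ n := by
          refine ENNReal.tsum_le_tsum fun n => ?_
          have h1 := he_norm n
          rw [norm_weighted_interSpace] at h1
          rw [← ENNReal.ofReal_toReal ((mem_weighted_interSpace hv).1 (he n)).ne]
          refine (ENNReal.ofReal_le_ofReal h1).trans_eq ?_
          rw [ENNReal.ofReal_pow (by norm_num), one_div, ENNReal.ofReal_inv_of_pos two_pos,
            ENNReal.ofReal_ofNat]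
      _ < ∞ := by
          rw [ENNReal.tsum_geometric, ENNReal.one_sub_inv_two, inv_inv]
          simp
  let g : α × β →ₘ[μ.prod ν] ℂ := AEEqFun.mk (fun x => (((S x).toReal / v x : ℝ) : ℂ))
    (Complex.measurable_ofReal.comp (mS.ennreal_toReal.div hv)).aestronglyMeasurable
  have g_coe : ∀ᵐ x ∂μ.prod ν, g x = (((S x).toReal / v x : ℝ) : ℂ) := AEEqFun.coeFn_mk _ _
  refine ⟨g, (mem_weighted_interSpace hv).2 (lt_of_le_of_lt (mixedInter_mono_ae ?_) hS),
    fun n => ?_⟩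
  · filter_upwards [g_coe] with x hx
    rw [hx, ← Complex.ofReal_mul, mul_div_cancel₀ _ (hv_pos x).ne', ← ofReal_norm,
      Complex.norm_real, Real.norm_of_nonneg ENNReal.toReal_nonneg]
    exact ENNReal.ofReal_toReal_le
  · filter_upwards [g_coe, ae_lt_top_of_mixedInter_lt_top hS] with x hx hSx
    rw [hx, Complex.norm_real, Real.norm_of_nonneg (div_nonneg ENNReal.toReal_nonneg
      (hv_pos x).le), le_div_iff₀ (hv_pos x)]
    have h1 : (G n x).toReal ≤ (S x).toReal :=
      ENNReal.toReal_mono hSx.ne (ENNReal.le_tsum (f := fun n => G n x) n)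
    simpa [G, abs_of_pos (hv_pos x), mul_comm] using h1

end WeightedInter

/-! ### The associate norm and sets of small support -/

section DualNorm

variable {α β : Type*} [MeasurableSpace α] [MeasurableSpace β]

/-- The norm of the associate space of `L¹ ∩ L^∞ ∩ L^{1,∞} ∩ L^{∞,1}`. -/
def dualNorm (μ : Measure α) (ν : Measure β) (F : α × β → ℝ≥0∞) : ℝ≥0∞ :=
  ⨆ (g : α × β → ℝ≥0∞) (_ : Measurable g) (_ : mixedInter μ ν g ≤ 1),
    ∫⁻ p, g p * F p ∂μ.prod ν

theorem lintegral_mul_le_dualNorm {μ : Measure α} {ν : Measure β} (F : α × β → ℝ≥0∞)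
    {g : α × β → ℝ≥0∞} (hg : Measurable g) (hg_le : mixedInter μ ν g ≤ 1) :
    ∫⁻ p, g p * F p ∂μ.prod ν ≤ dualNorm μ ν F :=
  le_iSup_of_le g <| le_iSup_of_le hg <| le_iSup_of_le hg_le le_rfl

theorem dualNorm_mono_ae {μ : Measure α} {ν : Measure β} {F G : α × β → ℝ≥0∞}
    (h : ∀ᵐ p ∂μ.prod ν, F p ≤ G p) : dualNorm μ ν F ≤ dualNorm μ ν G := by
  refine iSup_mono fun g => iSup_mono fun _ => iSup_mono fun _ => lintegral_mono_ae ?_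
  filter_upwards [h] with p hp
  gcongr

theorem mul_dualNorm_le {μ : Measure α} {ν : Measure β} {F : α × β → ℝ≥0∞} (hF : Measurable F)
    (c : ℝ≥0∞) : c * dualNorm μ ν F ≤ dualNorm μ ν fun p => c * F p := by
  simp only [dualNorm, ENNReal.mul_iSup]
  refine iSup_mono fun g => iSup_mono fun hg => iSup_mono fun _ => ?_
  rw [← lintegral_const_mul _ (by fun_prop)]
  exact lintegral_mono fun p => (mul_left_comm _ _ _).le

/-- A uniform boundedness principle: if unit-ball functions `g n` had pairings at least `2 ^ n * n`,
the admissible function `∑ 2⁻ⁿ g n` would have a pairing above every `n`. -/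
theorem dualNorm_lt_top {μ : Measure α} {ν : Measure β} [SFinite μ] [SFinite ν]
    {F : α × β → ℝ≥0∞} (hF : Measurable F)
    (h : ∀ g : α × β → ℝ≥0∞, Measurable g → mixedInter μ ν g < ∞ →
      ∫⁻ p, g p * F p ∂μ.prod ν < ∞) : dualNorm μ ν F < ∞ := by
  by_contra htop
  rw [not_lt_top_iff] at htop
  have hex : ∀ n : ℕ, ∃ g : α × β → ℝ≥0∞, Measurable g ∧ mixedInter μ ν g ≤ 1 ∧
      2 ^ n * n ≤ ∫⁻ p, g p * F p ∂μ.prod ν := by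
    intro n
    have hn : (2 : ℝ≥0∞) ^ n * n < dualNorm μ ν F := by
      rw [htop]
      exact ENNReal.mul_lt_top (ENNReal.pow_lt_top (by simp)) (by simp)
    simp only [dualNorm, lt_iSup_iff] at hn
    obtain ⟨g, hg, hg1, hlt⟩ := hn
    exact ⟨g, hg, hg1, hlt.le⟩
  choose g mg g_le hg using hex
  have mterm : ∀ n : ℕ, Measurable fun p => (2 : ℝ≥0∞)⁻¹ ^ n * g n p := fun n =>
    (mg n).const_mul _
  have hfin := h (fun p => ∑' n : ℕ, (2 : ℝ≥0∞)⁻¹ ^ n * g n p) (Measurable.tsum mterm) <| by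
    calc _ ≤ ∑' n : ℕ, mixedInter μ ν (fun p => (2 : ℝ≥0∞)⁻¹ ^ n * g n p) :=
          mixedInter_tsum_le mterm
      _ ≤ ∑' n : ℕ, (2 : ℝ≥0∞)⁻¹ ^ n := ENNReal.tsum_le_tsum fun n =>
          (mixedInter_const_mul_le (mg n) _).trans (mul_le_of_le_one_right zero_le (g_le n))
      _ < ∞ := by
          rw [ENNReal.tsum_geometric, ENNReal.one_sub_inv_two, inv_inv]
          simp
  obtain ⟨n, hn⟩ := ENNReal.exists_nat_gt hfin.ne
  refine hn.not_ge ?_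
  calc (n : ℝ≥0∞) = 2⁻¹ ^ n * (2 ^ n * n) := by
        rw [← mul_assoc, ← mul_pow, ENNReal.inv_mul_cancel (by simp) (by simp), one_pow, one_mul]
    _ ≤ 2⁻¹ ^ n * ∫⁻ p, g n p * F p ∂μ.prod ν := by
        gcongr
        exact hg n
    _ = ∫⁻ p, 2⁻¹ ^ n * g n p * F p ∂μ.prod ν := by
        rw [← lintegral_const_mul _ (by have := mg n; fun_prop)]
        simp only [mul_assoc]
    _ ≤ _ := by
        refine lintegral_mono fun p => ?_
        gcongr
        exact ENNReal.le_tsum (f := fun n : ℕ => (2 : ℝ≥0∞)⁻¹ ^ n * g n p) n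

/-- Supplies the localising set of both parts: countably many pieces with bounded `r` inside finite
rectangles exhaust `D`, so one of them is not null. -/
theorem exists_subset_measure_ne_zero {μ : Measure α} {ν : Measure β} [SigmaFinite μ]
    [SigmaFinite ν] {r : α × β → ℝ} (hr : Measurable r) {D : Set (α × β)} (hD : MeasurableSet D)
    (hD0 : μ.prod ν D ≠ 0) :
    ∃ E ⊆ D, MeasurableSet E ∧ μ.prod ν E ≠ 0 ∧ μ.prod ν E < ∞ ∧
      mixedInter μ ν (E.indicator 1) < ∞ ∧ ∃ n : ℕ, ∀ p ∈ E, r p ≤ n := by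
  let E : ℕ → Set (α × β) := fun n =>
    D ∩ ((spanningSets μ n ×ˢ spanningSets ν n) ∩ {p | r p ≤ n})
  have hE : D = ⋃ n, E n := by
    refine Set.Subset.antisymm (fun p hp => ?_) (Set.iUnion_subset fun n => Set.inter_subset_left)
    obtain ⟨i, hi⟩ := Set.mem_iUnion.1 ((iUnion_spanningSets μ).symm ▸ Set.mem_univ p.1)
    obtain ⟨j, hj⟩ := Set.mem_iUnion.1 ((iUnion_spanningSets ν).symm ▸ Set.mem_univ p.2)
    obtain ⟨k, hk⟩ := exists_nat_ge (r p)
    refine Set.mem_iUnion.2 ⟨max (max i j) k, hp, ⟨monotone_spanningSets μ ?_ hi,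
      monotone_spanningSets ν ?_ hj⟩, hk.trans ?_⟩
    · simp
    · simp
    · exact_mod_cast le_max_right _ _
  have : ∃ n, μ.prod ν (E n) ≠ 0 := by
    by_contra! h
    exact hD0 (hE ▸ measure_iUnion_null h)
  obtain ⟨n, hn⟩ := this
  have hsub : E n ⊆ spanningSets μ n ×ˢ spanningSets ν n := fun p hp => hp.2.1
  have h1 := measure_spanningSets_lt_top μ n
  have h2 := measure_spanningSets_lt_top ν n
  refine ⟨E n, Set.inter_subset_left, hD.inter
    (((measurableSet_spanningSets μ n).prod (measurableSet_spanningSets ν n)).inter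
      (measurableSet_le hr measurable_const)), hn, ?_,
    mixedInter_indicator_lt_top (measurableSet_spanningSets μ n) (measurableSet_spanningSets ν n)
      h1 h2 hsub, n, fun p hp => hp.2.2⟩
  refine (measure_mono hsub).trans_lt ?_
  rw [Measure.prod_prod]
  exact ENNReal.mul_lt_top h1 h2

end DualNorm

/-! ### The two embeddings -/

section Embeddings

variable {X₁ X₂ Y₁ Y₂ : Type*} [MeasurableSpace X₁] [MeasurableSpace X₂]
  [MeasurableSpace Y₁] [MeasurableSpace Y₂]
  {μ₁ : Measure X₁} {μ₂ : Measure X₂} {ν₁ : Measure Y₁} {ν₂ : Measure Y₂}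
  [SigmaFinite μ₁] [SigmaFinite μ₂] [SigmaFinite ν₁] [SigmaFinite ν₂]

theorem weighted_interSpace_embeds {m : (X₁ × X₂) × (Y₁ × Y₂) → ℝ}
    (hm_pos : ∀ p, 0 < m p) {A : FunctionSpace (ν₁.prod ν₂)} (hA : A.IsSolidBanach)
    {B : FunctionSpace (μ₁.prod μ₂)} (hB : B.IsSolidBanach)
    {v : X₁ × X₂ → ℝ} (hv : Measurable v) (hv_pos : ∀ x, 0 < v x)
    {w : Y₁ × Y₂ → ℝ} (hw : Measurable w)
    {C : ℝ} (hC : 0 < C) (hmvw : ∀ x y, m (x, y) ≤ C * v x * w y) (hA0 : A.carrier ≠ {0})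
    (hK : ∀ K ∈ kernelModule μ₁ μ₂ ν₁ ν₂ m, InducesOperator K A B) :
    ((interSpace μ₁ μ₂).weighted v hv).ContinuouslyEmbeds B := by
  obtain ⟨f, hf, hf0⟩ : ∃ f ∈ A.carrier, f ≠ 0 := by
    by_contra! h
    exact hA0 (Set.Subset.antisymm h (Set.singleton_subset_iff.2 hA.zero_mem))
  have mf : Measurable f := f.measurable
  have mD : MeasurableSet {y | f y ≠ 0} := (mf (measurableSet_singleton 0)).compl
  have hD : ν₁.prod ν₂ {y | f y ≠ 0} ≠ 0 := fun h => hf0 <| AEEqFun.ext <| by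
    have h' : ∀ᵐ y ∂ν₁.prod ν₂, f y = 0 := ae_iff.2 h
    filter_upwards [h', AEEqFun.coeFn_zero (μ := ν₁.prod ν₂) (β := ℂ)] with y h1 h2
    rw [h1, h2, Pi.zero_apply]
  obtain ⟨E, hED, mE, hE0, hE_top, hE_inter, n, hn⟩ :=
    exists_subset_measure_ne_zero (r := fun y => max (w y) ‖f y‖) (hw.max mf.norm) mD hD
  have m1E : Measurable (E.indicator (1 : Y₁ × Y₂ → ℝ≥0∞)) := measurable_one.indicator mE
  -- The operator is applied to `|f|` instead of `f`, so that this factor is strictly positive and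
  -- can be divided out.
  let c : ℝ := ∫ y in E, ‖f y‖ ∂ν₁.prod ν₂
  have hc : 0 < c := by
    have hint : IntegrableOn (fun y => ‖f y‖) E (ν₁.prod ν₂) :=
      Measure.integrableOn_of_bounded (M := n) hE_top.ne mf.norm.aestronglyMeasurable
        ((ae_restrict_iff' mE).2 (ae_of_all _ fun y hy => by
          simpa using (le_max_right _ _).trans (hn y hy)))
    refine (setIntegral_pos_iff_support_of_nonneg_ae (ae_of_all _ fun y => norm_nonneg _)
      hint).2 ?_
    rw [Set.inter_eq_right.2 fun y hy => by simpa using hED hy]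
    exact pos_iff_ne_zero.2 hE0
  have hsub : ((interSpace μ₁ μ₂).weighted v hv).carrier ⊆ B.carrier := by
    intro h hh
    have mh : Measurable h := h.measurable
    let K : (X₁ × X₂) × (Y₁ × Y₂) → ℂ := fun p => h p.1 * E.indicator 1 p.2
    have mK : Measurable K :=
      (mh.comp measurable_fst).mul ((measurable_one.indicator mE).comp measurable_snd)
    have hKm : K ∈ kernelModule μ₁ μ₂ ν₁ ν₂ m := by
      refine ⟨mK, kernelNormB_lt_top μ₁ μ₂ ν₁ ν₂ (G := fun x => ‖(v x : ℂ) * h x‖ₑ)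
        (H := fun y => ENNReal.ofReal (C * n) * E.indicator 1 y) (by fun_prop)
        (m1E.const_mul _) (fun x y => ?_) ((mem_weighted_interSpace hv).1 hh)
        ((mixedInter_const_mul_le m1E _).trans_lt (ENNReal.mul_lt_top (by simp) hE_inter))⟩
      by_cases hy : y ∈ E
      · have h1 : m (x, y) ≤ v x * (C * n) := by
          have h2 : w y ≤ n := (le_max_left _ _).trans (hn y hy)
          calc m (x, y) ≤ C * v x * w y := hmvw x y
            _ ≤ C * v x * n := by
                have := hv_pos x
                gcongr
            _ = _ := by ring
        simp only [K, hy, Set.indicator_of_mem, Pi.one_apply, mul_one]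
        rw [enorm_mul, enorm_mul, mul_right_comm]
        gcongr
        rw [← ofReal_norm, ← ofReal_norm, Complex.norm_real, Complex.norm_real,
          Real.norm_of_nonneg (hm_pos _).le, Real.norm_of_nonneg (hv_pos _).le,
          ← ENNReal.ofReal_mul (hv_pos _).le]
        exact ENNReal.ofReal_le_ofReal h1
      · simp [K, hy]
    obtain ⟨-, g, hg, hgK⟩ := hK K hKm _ (hA.absClass_mem hf).1
    have hgh : (c : ℂ)⁻¹ • g = h := by
      refine AEEqFun.ext ?_
      filter_upwards [AEEqFun.coeFn_smul (c : ℂ)⁻¹ g, hgK] with x h1 h2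
      have h3 : ∫ y, K (x, y) * absClass f y ∂ν₁.prod ν₂ = h x * (c : ℂ) := by
        rw [← integral_complex_ofReal, ← integral_indicator mE, ← integral_const_mul]
        refine integral_congr_ae ?_
        filter_upwards [coeFn_absClass f] with y hy
        by_cases hyE : y ∈ E <;> simp [K, hyE, hy]
      rw [h1, Pi.smul_apply, h2, h3, smul_eq_mul, mul_left_comm,
        inv_mul_cancel₀ (Complex.ofReal_ne_zero.2 hc.ne'), mul_one]
    exact hgh ▸ hB.smul_mem _ g hg
  refine ⟨hsub, exists_bound_of_dominated (fun f _ => ENNReal.toReal_nonneg)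
    (fun c f hf => (weighted_interSpace_smul hv c hf).1)
    (fun c f hf => (weighted_interSpace_smul hv c hf).2)
    (fun c hc f hf => ?_) (fun f _ g hg h => (hB.solid g (hsub hg) f h).2)
    (weighted_interSpace_dominated hv hv_pos)⟩
  rw [hB.norm_smul _ f (hsub hf), Complex.norm_real, Real.norm_of_nonneg hc]

theorem embeds_weighted_sumSpace {m : (X₁ × X₂) × (Y₁ × Y₂) → ℝ}
    (hm_pos : ∀ p, 0 < m p) {A : FunctionSpace (ν₁.prod ν₂)} (hA : A.IsSolidBanach)
    {v : X₁ × X₂ → ℝ} (hv : Measurable v)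
    {w : Y₁ × Y₂ → ℝ} (hw : Measurable w) (hw_pos : ∀ y, 0 < w y)
    {C : ℝ} (hC : 0 < C) (hmvw : ∀ x y, m (x, y) ≤ C * v x * w y)
    (hμ : (μ₁.prod μ₂) Set.univ ≠ 0)
    (hK : ∀ K ∈ kernelModule μ₁ μ₂ ν₁ ν₂ m, (∀ p, 0 ≤ K p) →
      ∀ f ∈ A.carrier, (∀ᵐ y ∂(ν₁.prod ν₂), 0 ≤ f y) →
        ∀ᵐ x ∂(μ₁.prod μ₂), nonnegIntegralOperator (ν₁.prod ν₂) K f x < ∞) :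
    A.ContinuouslyEmbeds
      ((sumSpace ν₁ ν₂).weighted (fun y => 1 / w y) (measurable_const.div hw)) := by
  obtain ⟨E, -, mE, hE0, -, hE_inter, n, hn⟩ :=
    exists_subset_measure_ne_zero hv MeasurableSet.univ hμ
  have m1E : Measurable (E.indicator (1 : X₁ × X₂ → ℝ≥0∞)) := measurable_one.indicator mE
  let F : (Y₁ × Y₂ →ₘ[ν₁.prod ν₂] ℂ) → Y₁ × Y₂ → ℝ≥0∞ :=
    fun f y => ENNReal.ofReal (w y)⁻¹ * ‖f y‖ₑ
  have mF : ∀ f, Measurable (F f) := fun f => hw.inv.ennreal_ofReal.mul f.measurable.enorm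
  have F_top : ∀ f ∈ A.carrier, dualNorm ν₁ ν₂ (F f) < ∞ := by
    intro f hf
    refine dualNorm_lt_top (mF f) fun g mg hg => ?_
    -- The factor `1 / w` cancels the weight in `m ≤ C v w`. Truncating by `toReal` changes `g` only
    -- on a null set, since `g` has finite norm.
    let K : (X₁ × X₂) × (Y₁ × Y₂) → ℂ := fun p =>
      ((E.indicator 1 p.1 * ((g p.2).toReal * (w p.2)⁻¹) : ℝ) : ℂ)
    have mK : Measurable K := Complex.measurable_ofReal.comp <|
      ((measurable_one.indicator mE).comp measurable_fst).mul
        ((mg.ennreal_toReal.mul hw.inv).comp measurable_snd)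
    have K_nonneg : ∀ p, 0 ≤ K p := fun p => Complex.zero_le_real.2 <|
      mul_nonneg (Set.indicator_nonneg (fun _ _ => zero_le_one) _)
        (mul_nonneg ENNReal.toReal_nonneg (inv_nonneg.2 (hw_pos _).le))
    have hKm : K ∈ kernelModule μ₁ μ₂ ν₁ ν₂ m := by
      refine ⟨mK, kernelNormB_lt_top μ₁ μ₂ ν₁ ν₂
        (G := fun x => ENNReal.ofReal (C * n) * E.indicator 1 x) (H := g)
        (m1E.const_mul _) mg (fun x y => ?_)
        ((mixedInter_const_mul_le m1E _).trans_lt (ENNReal.mul_lt_top (by simp) hE_inter)) hg⟩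
      by_cases hx : x ∈ E
      · have hwy := hw_pos y
        have h1 : m (x, y) * ((g y).toReal * (w y)⁻¹) ≤ C * n * (g y).toReal := by
          calc m (x, y) * ((g y).toReal * (w y)⁻¹)
              ≤ C * n * w y * ((g y).toReal * (w y)⁻¹) := by
                refine mul_le_mul_of_nonneg_right ((hmvw x y).trans ?_) (by positivity)
                have := hn x hx
                gcongr
            _ = C * n * (g y).toReal := by field_simp
        have h2 : 0 ≤ m (x, y) * ((g y).toReal * (w y)⁻¹) := by
          have := hm_pos (x, y)
          positivity
        simp only [K, hx, Set.indicator_of_mem, Pi.one_apply, mul_one, one_mul]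
        rw [← Complex.ofReal_mul, ← ofReal_norm, Complex.norm_real, Real.norm_of_nonneg h2]
        refine (ENNReal.ofReal_le_ofReal h1).trans ?_
        rw [ENNReal.ofReal_mul (by positivity)]
        gcongr
        exact ENNReal.ofReal_toReal_le
      · simp [K, hx]
    have hae := hK K hKm K_nonneg _ (hA.absClass_mem hf).1
      ((coeFn_absClass f).mono fun y hy => hy ▸ Complex.zero_le_real.2 (norm_nonneg _))
    -- Since `E` is not null, finiteness almost everywhere holds at some point of `E`, where the
    -- operator equals the pairing of `g` with `|f| / w`.
    obtain ⟨x, hxE, hx⟩ := ((frequently_ae_mem_iff.2 hE0).and_eventually hae).exists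
    refine lt_of_le_of_lt (le_of_eq (lintegral_congr_ae ?_)) hx
    filter_upwards [coeFn_absClass f, ae_lt_top_of_mixedInter_lt_top hg] with y h1 h2
    rw [h1, ← Complex.ofReal_mul, Complex.ofReal_re]
    simp only [hxE, Set.indicator_of_mem, Pi.one_apply, one_mul]
    rw [ENNReal.ofReal_mul (mul_nonneg ENNReal.toReal_nonneg (inv_nonneg.2 (hw_pos _).le)),
      ENNReal.ofReal_mul ENNReal.toReal_nonneg, ENNReal.ofReal_toReal h2.ne, ofReal_norm,
      mul_assoc]
  have sum_le : ∀ f : Y₁ × Y₂ →ₘ[ν₁.prod ν₂] ℂ,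
      sumNorm ν₁ ν₂ (AEEqFun.mk (fun y => ((1 / w y : ℝ) : ℂ)) (Complex.measurable_ofReal.comp
        (measurable_const.div hw)).aestronglyMeasurable * f) ≤ 16 * dualNorm ν₁ ν₂ (F f) := by
    intro f
    obtain ⟨g, mg, hg, hle⟩ := exists_sumNorm_le_pairing ν₁ ν₂
      (AEEqFun.mk (fun y => ((1 / w y : ℝ) : ℂ)) (Complex.measurable_ofReal.comp
        (measurable_const.div hw)).aestronglyMeasurable * f)
    refine hle.trans (mul_le_mul_right ?_ 16)
    refine le_trans (le_of_eq (lintegral_congr_ae ?_)) (lintegral_mul_le_dualNorm (F f) mg hg)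
    filter_upwards [coeFn_weight_mul (v := fun y => 1 / w y) (measurable_const.div hw) f] with y hy
    rw [hy, enorm_mul, ← ofReal_norm (Complex.ofReal _), Complex.norm_real, one_div,
      Real.norm_of_nonneg (inv_nonneg.2 (hw_pos _).le)]
  -- The gliding hump is run on `dualNorm`, which is visibly monotone and homogeneous, and the sum
  -- norm is compared with it only afterwards.
  have bound : ∃ c : ℝ, ∀ f ∈ A.carrier, (dualNorm ν₁ ν₂ (F f)).toReal ≤ c * A.norm f := by
    refine exists_bound_of_dominated hA.norm_nonneg hA.smul_mem
      (fun c f hf => (hA.norm_smul c f hf).le) (fun c hc f hf => ?_)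
      (fun f hf g hg h => ENNReal.toReal_mono (F_top g hg).ne
        (dualNorm_mono_ae (h.mono fun y hy => ?_))) hA.dominated
    · rw [← ENNReal.toReal_ofReal hc, ← ENNReal.toReal_mul, ENNReal.toReal_ofReal hc]
      refine ENNReal.toReal_mono (F_top _ (hA.smul_mem _ f hf)).ne
        ((mul_dualNorm_le (mF f) _).trans (dualNorm_mono_ae ?_))
      filter_upwards [AEEqFun.coeFn_smul (c : ℂ) f] with y hy
      simp only [F]
      rw [hy, Pi.smul_apply, enorm_smul, ← ofReal_norm (c : ℂ), Complex.norm_real,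
        Real.norm_of_nonneg hc, mul_left_comm]
    · simp only [F]
      gcongr
      exact enorm_le_iff_norm_le.2 hy
  obtain ⟨c, hc⟩ := bound
  refine ⟨fun f hf => (sum_le f).trans_lt (ENNReal.mul_lt_top (by simp) (F_top f hf)), 16 * c,
    fun f hf => ?_⟩
  refine (ENNReal.toReal_mono (ENNReal.mul_lt_top (by simp) (F_top f hf)).ne (sum_le f)).trans ?_
  rw [ENNReal.toReal_mul, ENNReal.toReal_ofNat, mul_assoc]
  exact mul_le_mul_of_nonneg_left (hc f hf) (by norm_num)

end Embeddings

end KernelModules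

end

theorem mainTheorem7
    {X₁ X₂ Y₁ Y₂ : Type*} [MeasurableSpace X₁] [MeasurableSpace X₂]
    [MeasurableSpace Y₁] [MeasurableSpace Y₂]
    (μ₁ : Measure X₁) (μ₂ : Measure X₂) (ν₁ : Measure Y₁) (ν₂ : Measure Y₂)
    [SigmaFinite μ₁] [SigmaFinite μ₂] [SigmaFinite ν₁] [SigmaFinite ν₂]
    (m : (X₁ × X₂) × (Y₁ × Y₂) → ℝ) (hm : Measurable m) (hm_pos : ∀ p, 0 < m p)
    (A : KernelModules.FunctionSpace (ν₁.prod ν₂)) (hA : A.IsSolidBanach)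
    (B : KernelModules.FunctionSpace (μ₁.prod μ₂)) (hB : B.IsSolidBanach)
    (v : X₁ × X₂ → ℝ) (hv : Measurable v) (hv_pos : ∀ x, 0 < v x)
    (w : Y₁ × Y₂ → ℝ) (hw : Measurable w) (hw_pos : ∀ y, 0 < w y)
    (C : ℝ) (hC : 0 < C) (hmvw : ∀ x y, m (x, y) ≤ C * v x * w y) :
    (A.carrier ≠ {0} →
      (∀ K ∈ KernelModules.kernelModule μ₁ μ₂ ν₁ ν₂ m, KernelModules.InducesOperator K A B) →
      ((KernelModules.interSpace μ₁ μ₂).weighted v hv).ContinuouslyEmbeds B) ∧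
    ((μ₁.prod μ₂) Set.univ ≠ 0 →
      (∀ K ∈ KernelModules.kernelModule μ₁ μ₂ ν₁ ν₂ m, (∀ p, 0 ≤ K p) →
        ∀ f ∈ A.carrier, (∀ᵐ y ∂(ν₁.prod ν₂), 0 ≤ f y) →
          ∀ᵐ x ∂(μ₁.prod μ₂),
            KernelModules.nonnegIntegralOperator (ν₁.prod ν₂) K f x < ∞) →
      A.ContinuouslyEmbeds
        ((KernelModules.sumSpace ν₁ ν₂).weighted (fun y => 1 / w y)
          (measurable_const.div hw))) :=
  ⟨fun hA0 hK => KernelModules.weighted_interSpace_embeds hm_pos hA hB hv hv_pos hw hC hmvw hA0 hK,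
    fun hμ hK => KernelModules.embeds_weighted_sumSpace hm_pos hA hv hw hw_pos hC hmvw hμ hK⟩
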